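/- Names are infinite binary sequences $p\in\{0,1\}^{\mathbb N}$, and a representation $\delta$ of a set $X$ is a surjective partial map $\delta:\subseteq\{0,1\}^{\mathbb N}\to X$. A partial map $f:\subseteq X\to Y$ between represented spaces $(X,\delta),(Y,\delta')$ is called $(\delta,\delta')$-computable if a single Turing machine with one-way output transforms every $\delta$-name of every $x\in\operatorname{dom} f$ into some $\delta'$-name of $f(x)$. Represent $\mathbb N$ by $\delta_{\mathbb N}(1^n0^\omega)=n$, let $[\delta\to\delta']$ be the standard representation of the $(\delta,\delta')$-continuous total functions $X\to Y$ (a name encodes a program together with an oracle that maps each $\delta$-name of each $x$ to a $\delta'$-name of the value at $x$), and put $\delta^{\mathbb N}=[\delta_{\mathbb N}\to\delta]$ on $X^{\mathbb N}$. For a dense sequence $\alpha$ in a metric space, the Cauchy representation names $x$ by $01^{n_0+1}01^{n_1+1}01^{n_2+1}\cdots$ whenever $\alpha(n_i)\to x$ and $d(\alpha(n_i),\alpha(n_j))<2^{-i}$ for all $j>i$; $\mathbb R$ and $\mathbb C$ carry the Cauchy representations $\delta_{\mathbb R},\delta_{\mathbb C}$ given by standard numberings $\alpha_{\mathbb R}$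 of $\mathbb Q$ and $\alpha_{\mathbb C}$ of $\mathbb Q[i]$. Let $(H,\langle\cdot,\cdot\rangle,e)$ be a computable complex Hilbert space: $H$ is a Hilbert space, $e:\mathbb N\to H$ has dense linear span, and for the sequence $\alpha_e\langle k,\langle n_0,\dots,n_k\rangle\rangle=\sum_{i=0}^k\alpha_{\mathbb C}(n_i)e_i$ (which is dense in $H$) the double sequence $(i,j)\mapsto\|\alpha_e(i)-\alpha_e(j)\|$ of reals is computable. Let $\delta_H$ be the Cauchy representation of $H$ given by $\alpha_e$, and let $\delta_{H'}$ be the representation of the dual space $H'$ in which $\langle p,q\rangle$ is a name of $\Lambda$ if and only if $p$ is a $[\delta_H\to\delta_{\mathbb C}]$-name of $\Lambda$ and $q$ is a $\delta_{\mathbb R}$-name of $\|\Lambda\|$. A sequence $(f_i)_{i\in\mathbb N}$ in $H$ is a frame if there are $A,B>0$ with $A\|f\|^2\le\sum_i|\langle f,f_i\rangle|^2\le B\|f\|^2$ for all $f\in H$; a sequence $(\Lambda_i)_{i\in\mathbb N}$ in $H'$ is a g-frame for $H$ with respect to $\mathbb C$ if there are $A,B>0$ with $A\|f\|^2\le\sum_i|\Lambda_i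 f|^2\le B\|f\|^2$ for all $f\in H$. **Theorem.** The map $\phi:\subseteq H^{\mathbb N}\to {H'}^{\mathbb N}$, $(f_i)\mapsto(\Lambda_{f_i})$ with $\Lambda_{y}(x)=\langle x,y\rangle$, whose domain is the set of all frames for $H$, is a bijection from the frames for $H$ onto the g-frames for $H$ with respect to $\mathbb C$. It is $(\delta_H^{\mathbb N},\delta_{H'}^{\mathbb N})$-computable, and its inverse $\phi^{-1}$ is $(\delta_{H'}^{\mathbb N},\delta_H^{\mathbb N})$-computable. -/

import Mathlib

/-! ### Computable functions on Cantor space -/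

/-- Infinite sequences over the alphabet `{0, 1}`, with `0 = false` and `1 = true`. -/
abbrev Cantor : Type := ℕ → Bool

namespace Cantor

/-- The finite word formed by the first `k` symbols of `p`. -/
def take (p : Cantor) (k : ℕ) : List Bool := (List.range k).map p

/-- The finite word `w` is an initial segment of the infinite sequence `p`. -/
def HasPrefix (p : Cantor) (w : List Bool) : Prop := p.take w.length = w

/-- The interleaving `⟨p, q⟩ = p 0, q 0, p 1, q 1, …`. -/
def pair (p q : Cantor) : Cantor := fun n => if n % 2 = 0 then p (n / 2) else q (n / 2)

/-- The sequence `w` followed by `p`. -/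
def append (w : List Bool) (p : Cantor) : Cantor :=
  fun n => if h : n < w.length then w[n] else p (n - w.length)

/-- The program `c` transforms the infinite input `p` into the infinite output `q`. Having read a
finite initial segment of `p`, the program may write a finite word (the value of the partial
recursive function `c.eval`, with words coded by natural numbers); everything it writes is an
initial segment of `q`, and it writes arbitrarily long initial segments of `q`. There is at most one
such `q`, so that `c` computes the partial function `p ↦ q` on Cantor space. -/
def Transforms (c : Nat.Partrec.Code) (p q : Cantor) : Prop :=
  (∀ (k : ℕ) (v : List Bool),
      Encodable.encode v ∈ c.eval (Encodable.encode (p.take k)) → q.HasPrefix v) ∧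
  ∀ m : ℕ, ∃ (k : ℕ) (v : List Bool),
    Encodable.encode v ∈ c.eval (Encodable.encode (p.take k)) ∧ m ≤ v.length

/-- The standard representation `η` of continuous partial functions on Cantor space: the sequence
`0ⁿ 1 r` represents the partial function `y ↦ z`, where `z` is the output of the `n`-th program on
the input `⟨r, y⟩`. -/
def Eta (p y z : Cantor) : Prop :=
  ∃ (n : ℕ) (r : Cantor), p = append (List.replicate n false ++ [true]) r ∧
    Transforms (Denumerable.ofNat Nat.Partrec.Code n) (pair r y) z

end Cantor

/-! ### Represented spaces -/

/-- A representation in the sense of type-two effectivity (a partial function from Cantor space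
onto `X`), given by its graph: `δ p x` says that `p` is a `δ`-name of `x`, that is, `δ(p) = x`. -/
abbrev TTERep (X : Type*) : Type _ := Cantor → X → Prop

/-- The partial function `f :⊆ X → Y` with domain `S` is `(δ, δ')`-computable: one program
transforms every `δ`-name of every `x ∈ S` into some `δ'`-name of `f x`. -/
def ComputableFunOn {X Y : Type*} (δ : TTERep X) (δ' : TTERep Y)
    (f : X → Y) (S : Set X) : Prop :=
  ∃ c : Nat.Partrec.Code, ∀ (p : Cantor) (x : X), δ p x → x ∈ S →
    ∃ q : Cantor, Cantor.Transforms c p q ∧ δ' q (f x)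

namespace TTERep

/-- The natural number `n` is represented by `1ⁿ 0 0 0 …`. -/
def nat : TTERep ℕ := fun p n => p = fun i => decide (i < n)

/-- The product representation: `⟨p, q⟩` names `(x, y)`. -/
def prod {X Y : Type*} (δ : TTERep X) (δ' : TTERep Y) : TTERep (X × Y) :=
  fun s x => ∃ p q : Cantor, s = Cantor.pair p q ∧ δ p x.1 ∧ δ' q x.2

/-- The function space representation `[δ → δ']`: `p` is a name of `f` if the partial function on
Cantor space represented by `p` maps every name of every `x` to a name of `f x`. Exactly the
`(δ, δ')`-continuous functions have names. -/
def func {X Y : Type*} (δ : TTERep X) (δ' : TTERep Y) : TTERep (X → Y) :=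
  fun p f => ∀ (y : Cantor) (x : X), δ y x → ∃ z : Cantor, Cantor.Eta p y z ∧ δ' z (f x)

/-- The representation `δ^ℕ = [δ_ℕ → δ]` of sequences. -/
def seq {X : Type*} (δ : TTERep X) : TTERep (ℕ → X) := func nat δ

/-- The word `0 1^{n₀ + 1} 0 1^{n₁ + 1} … 0 1^{n_{k-1} + 1}`. -/
def cauchyWord (n : ℕ → ℕ) (k : ℕ) : List Bool :=
  (List.range k).flatMap fun i => false :: List.replicate (n i + 1) true

/-- The Cauchy representation of a metric space with respect to a sequence `α`: the sequence
`0 1^{n₀ + 1} 0 1^{n₁ + 1} 0 1^{n₂ + 1} …` names `lim α(nᵢ)`, provided that the limit exists and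
`d(α(nᵢ), α(nⱼ)) < 2⁻ⁱ` for all `j > i`. -/
def cauchy {X : Type*} [MetricSpace X] (α : ℕ → X) : TTERep X :=
  fun p x => ∃ n : ℕ → ℕ, (∀ k, p.HasPrefix (cauchyWord n k)) ∧
    (∀ i j, i < j → dist (α (n i)) (α (n j)) < (2 : ℝ)⁻¹ ^ i) ∧
    Filter.Tendsto (fun i => α (n i)) Filter.atTop (nhds x)

/-- The standard numbering `⟨i, j, k⟩ ↦ (i - j) / (k + 1)` of the rational numbers. -/
noncomputable def alphaReal (m : ℕ) : ℝ :=
  ((m.unpair.1 : ℝ) - (m.unpair.2.unpair.1 : ℝ)) / ((m.unpair.2.unpair.2 : ℝ) + 1)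

/-- The standard numbering `⟨a, b⟩ ↦ α_ℝ(a) + α_ℝ(b) i` of the rational complex numbers. -/
noncomputable def alphaComplex (m : ℕ) : ℂ :=
  (alphaReal m.unpair.1 : ℂ) + (alphaReal m.unpair.2 : ℂ) * Complex.I

/-- The Cauchy representation of `ℝ`. -/
def real : TTERep ℝ := cauchy alphaReal

/-- The Cauchy representation of `ℂ`. -/
def complex : TTERep ℂ := cauchy alphaComplex

end TTERep

/-! ### Computable metric and Hilbert spaces -/

/-- `(X, d, α)` is a computable metric space. -/
def IsComputableMetricSpace {X : Type*} [MetricSpace X] (α : ℕ → X) : Prop :=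
  DenseRange α ∧
  ComputableFunOn (TTERep.prod TTERep.nat TTERep.nat) TTERep.real
    (fun ij : ℕ × ℕ => dist (α ij.1) (α ij.2)) Set.univ

/-- The entry `nᵢ` of the tuple `⟨n₀, ⟨n₁, … ⟨n_{k-1}, n_k⟩ … ⟩⟩` coded by `m`, for `i ≤ k`. -/
def tupleEntry (k m i : ℕ) : ℕ :=
  if i < k then ((fun r : ℕ => r.unpair.2)^[i] m).unpair.1 else (fun r : ℕ => r.unpair.2)^[k] m

section Hilbert

variable {H : Type*} [NormedAddCommGroup H] [InnerProductSpace ℂ H]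

/-- The sequence of rational linear combinations of a sequence `e`,
`α_e ⟨k, ⟨n₀, …, n_k⟩⟩ = ∑_{i ≤ k} α_ℂ(nᵢ) eᵢ`. -/
noncomputable def alphaSpan (e : ℕ → H) (m : ℕ) : H :=
  ∑ i ∈ Finset.range (m.unpair.1 + 1),
    TTERep.alphaComplex (tupleEntry m.unpair.1 m.unpair.2 i) • e i

/-- `(H, ⟨·,·⟩, e)` is a computable (complex) Hilbert space, where `H` is a Hilbert space. -/
def IsComputableHilbertSpace [CompleteSpace H] (e : ℕ → H) : Prop :=
  Dense (Submodule.span ℂ (Set.range e) : Set H) ∧ IsComputableMetricSpace (alphaSpan e)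

namespace TTERep

/-- The Cauchy representation `δ_H` of `(H, ⟨·,·⟩, e)`. -/
def hilbert (e : ℕ → H) : TTERep H := cauchy (alphaSpan e)

/-- The representation `δ_{H'}` of the dual space: `⟨p, q⟩` names `Λ` if `p` is a
`[δ_H → δ_ℂ]`-name of `Λ` and `q` is a name of the real number `‖Λ‖`. -/
def dual (e : ℕ → H) : TTERep (StrongDual ℂ H) :=
  fun s Λ => ∃ p q : Cantor, s = Cantor.pair p q ∧
    func (hilbert e) complex p (fun x => Λ x) ∧ real q ‖Λ‖

end TTERep

/-- The sequence `(fᵢ)` is a frame for `H`. -/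
def IsFrame (f : ℕ → H) : Prop :=
  ∃ A B : ℝ, 0 < A ∧ 0 < B ∧ ∀ x : H,
    Summable (fun i => ‖inner ℂ (f i) x‖ ^ 2) ∧
    A * ‖x‖ ^ 2 ≤ ∑' i, ‖inner ℂ (f i) x‖ ^ 2 ∧
    ∑' i, ‖inner ℂ (f i) x‖ ^ 2 ≤ B * ‖x‖ ^ 2

/-- The sequence `(Λᵢ)` of bounded operators `Λᵢ : H → Eᵢ` is a g-frame for `H` with respect
to `(Eᵢ)`. -/
def IsGFrame {E : ℕ → Type*} [∀ i, NormedAddCommGroup (E i)] [∀ i, InnerProductSpace ℂ (E i)]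
    (Λ : ∀ i, H →L[ℂ] E i) : Prop :=
  ∃ A B : ℝ, 0 < A ∧ 0 < B ∧ ∀ x : H,
    Summable (fun i => ‖Λ i x‖ ^ 2) ∧
    A * ‖x‖ ^ 2 ≤ ∑' i, ‖Λ i x‖ ^ 2 ∧
    ∑' i, ‖Λ i x‖ ^ 2 ≤ B * ‖x‖ ^ 2

/-- The map `(fᵢ) ↦ (Λ_{fᵢ})`, where `Λ_y(x) = ⟨x, y⟩` (linear in `x`; Mathlib's inner product is
linear in its second argument). -/
noncomputable def functionalSeq (f : ℕ → H) : ℕ → StrongDual ℂ H := fun i => innerSL ℂ (f i)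

end Hilbert

/-!
The Riesz isomorphism `f ↦ ⟨·, f⟩` turns the frame inequalities into the g-frame inequalities term
by term, so the bijection is the Riesz representation theorem, applied to each member of a
sequence. Computability is a matter of the single members: both directions are computable
uniformly in the index.

From a name of `f` one obtains a name of `⟨·, f⟩` because the inner product is computable. Its real
part is given by the distances `‖f‖`, `‖x‖`, `‖f - x‖` (polarization), and its imaginary part is
the real part of `⟨x, i f⟩`, where multiplication by `i` acts on the coefficients of rational
linear combinations. Conversely, given `Λ = ⟨·, f⟩` together with `‖Λ‖ = ‖f‖`, the distances
`‖v - f‖² = ‖v‖² + ‖Λ‖² - 2 Re Λ(v)` to the members `v` of the dense sequence are computable, so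
that good approximations of `f` can be found by search.

Programs are not written explicitly. The notion that carries the proof is `Semidec o P`: the
predicate `P t a` is semidecidable relative to the oracle `o t`, uniformly in `t`. Such predicates
are closed under conjunction, disjunction, existential and bounded universal quantification, and
under substitution of computable numbers (`Semidec.subst_nat`), and witnesses can be selected
computably (`Semidec.exists_natComputable`). A sequence, a real number or a point is computable if
its symbols, its rational cuts or its approximations are. These notions connect to programs through
`CantorComputable.exists_code` (a computable sequence is the output of one program),
`CantorComputable.of_eta` (the universal program), and `CantorComputable.exists_func_name` (names
of functions with an oracle as parameter), and to Cauchy names through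
`CantorComputable.exists_cauchy_name` and `PointComputable.of_name`.
-/

/-! ### Primitive recursive predicates -/

attribute [fun_prop] Primrec PrimrecPred
attribute [fun_prop] Primrec.comp Primrec.id Primrec.const Primrec.pair Primrec.fst Primrec.snd
  Primrec.unpair Primrec.encode PrimrecPred.and PrimrecPred.or PrimrecPred.not

section Primrec

variable {A B : Type*} [Primcodable A] [Primcodable B]

@[fun_prop]
theorem Primrec.fun_nat_add {f g : A → ℕ} (hf : Primrec f) (hg : Primrec g) :
    Primrec fun a => f a + g a := Primrec.nat_add.comp hf hg

@[fun_prop]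
theorem Primrec.fun_nat_mul {f g : A → ℕ} (hf : Primrec f) (hg : Primrec g) :
    Primrec fun a => f a * g a := Primrec.nat_mul.comp hf hg

@[fun_prop]
theorem Primrec.fun_nat_sub {f g : A → ℕ} (hf : Primrec f) (hg : Primrec g) :
    Primrec fun a => f a - g a := Primrec.nat_sub.comp hf hg

@[fun_prop]
theorem Primrec.fun_nat_div {f g : A → ℕ} (hf : Primrec f) (hg : Primrec g) :
    Primrec fun a => f a / g a := Primrec.nat_div.comp hf hg

@[fun_prop]
theorem Primrec.fun_nat_mod {f g : A → ℕ} (hf : Primrec f) (hg : Primrec g) :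
    Primrec fun a => f a % g a := Primrec.nat_mod.comp hf hg

@[fun_prop]
theorem Primrec.fun_nat_pow {f g : A → ℕ} (hf : Primrec f) (hg : Primrec g) :
    Primrec fun a => f a ^ g a :=
  (Primrec₂.unpaired'.1 Nat.Primrec.pow).comp hf hg

@[fun_prop]
theorem Primrec.fun_nat_pair {f g : A → ℕ} (hf : Primrec f) (hg : Primrec g) :
    Primrec fun a => Nat.pair (f a) (g a) := Primrec₂.natPair.comp hf hg

@[fun_prop]
theorem Primrec.fun_list_length {f : A → List B} (hf : Primrec f) :
    Primrec fun a => (f a).length := Primrec.list_length.comp hf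

@[fun_prop]
theorem Primrec.fun_list_range {f : A → ℕ} (hf : Primrec f) :
    Primrec fun a => List.range (f a) := Primrec.list_range.comp hf

@[fun_prop]
theorem Primrec.fun_list_append {f g : A → List B} (hf : Primrec f) (hg : Primrec g) :
    Primrec fun a => f a ++ g a := Primrec.list_append.comp hf hg

@[fun_prop]
theorem Primrec.fun_list_cons {f : A → B} {g : A → List B} (hf : Primrec f) (hg : Primrec g) :
    Primrec fun a => f a :: g a := Primrec.list_cons.comp hf hg

@[fun_prop]
theorem Primrec.fun_list_take {f : A → ℕ} {g : A → List B} (hf : Primrec f) (hg : Primrec g) :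
    Primrec fun a => (g a).take (f a) := Primrec.list_take.comp hf hg

@[fun_prop]
theorem Primrec.fun_list_getElem? {f : A → List B} {g : A → ℕ} (hf : Primrec f) (hg : Primrec g) :
    Primrec fun a => (f a)[g a]? := Primrec.list_getElem?.comp hf hg

@[fun_prop]
theorem Primrec.fun_some {f : A → B} (hf : Primrec f) :
    Primrec fun a => some (f a) := Primrec.option_some.comp hf

@[fun_prop]
theorem Primrec.fun_list_replicate {f : A → ℕ} {g : A → B} (hf : Primrec f) (hg : Primrec g) :
    Primrec fun a => List.replicate (f a) (g a) :=
  (Primrec.list_map (f := fun a => List.range (f a)) (g := fun a _ => g a) (by fun_prop)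
    (hg.comp Primrec.fst)).of_eq fun a => by simp

@[fun_prop]
theorem PrimrecPred.fun_eq {f g : A → B} (hf : Primrec f) (hg : Primrec g) :
    PrimrecPred fun a => f a = g a := Primrec.eq.comp hf hg

@[fun_prop]
theorem PrimrecPred.fun_lt {f g : A → ℕ} (hf : Primrec f) (hg : Primrec g) :
    PrimrecPred fun a => f a < g a := Primrec.nat_lt.comp hf hg

@[fun_prop]
theorem PrimrecPred.fun_le {f g : A → ℕ} (hf : Primrec f) (hg : Primrec g) :
    PrimrecPred fun a => f a ≤ g a := Primrec.nat_le.comp hf hg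

theorem PrimrecPred.exists_mem {f : A → List B} {R : A × B → Prop} (hf : Primrec f)
    (hR : PrimrecPred R) : PrimrecPred fun a => ∃ b ∈ f a, R (a, b) :=
  (PrimrecRel.exists_mem_list (R := fun b a => R (a, b))
    (hR.comp (f := fun x : B × A => (x.2, x.1)) (by fun_prop))).comp hf Primrec.id

theorem PrimrecPred.forall_mem {f : A → List B} {R : A × B → Prop} (hf : Primrec f)
    (hR : PrimrecPred R) : PrimrecPred fun a => ∀ b ∈ f a, R (a, b) :=
  (PrimrecRel.forall_mem_list (R := fun b a => R (a, b))
    (hR.comp (f := fun x : B × A => (x.2, x.1)) (by fun_prop))).comp hf Primrec.id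

theorem PrimrecPred.forall_fun_lt {f : A → ℕ} {R : A × ℕ → Prop} (hf : Primrec f)
    (hR : PrimrecPred R) : PrimrecPred fun a => ∀ i < f a, R (a, i) :=
  (PrimrecPred.forall_mem (f := fun a => List.range (f a)) (by fun_prop) hR).of_eq
    fun a => by simp

theorem PrimrecPred.exists_fun_lt {f : A → ℕ} {R : A × ℕ → Prop} (hf : Primrec f)
    (hR : PrimrecPred R) : PrimrecPred fun a => ∃ i < f a, R (a, i) :=
  (PrimrecPred.exists_mem (f := fun a => List.range (f a)) (by fun_prop) hR).of_eq
    fun a => by simp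

end Primrec

/-! ### Initial segments -/

namespace Cantor

@[simp]
theorem length_take (p : Cantor) (k : ℕ) : (p.take k).length = k := by simp [take]

theorem getElem?_take (p : Cantor) (k j : ℕ) :
    (p.take k)[j]? = if j < k then some (p j) else none := by
  by_cases h : j < k <;> simp [take, h]

theorem take_take (p : Cantor) (j k : ℕ) : (p.take k).take j = p.take (min j k) := by
  apply List.ext_getElem?
  intro i
  simp only [List.getElem?_take, getElem?_take]
  split_ifs <;> first | rfl | omega

theorem hasPrefix_take (p : Cantor) (k : ℕ) : p.HasPrefix (p.take k) := by
  simp [HasPrefix]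

theorem hasPrefix_iff {p : Cantor} {w : List Bool} :
    p.HasPrefix w ↔ ∀ i < w.length, w[i]? = some (p i) := by
  constructor
  · intro h i hi
    rw [HasPrefix] at h
    rw [← h, getElem?_take, if_pos hi]
  · intro h
    apply List.ext_getElem?
    intro i
    rw [getElem?_take]
    split_ifs with hi
    · exact (h i hi).symm
    · simp only [not_lt] at hi
      simp [hi]

theorem HasPrefix.getElem? {p : Cantor} {w : List Bool} (h : p.HasPrefix w) {i : ℕ} {b : Bool}
    (hi : w[i]? = some b) : p i = b := by
  have hlt : i < w.length := by
    by_contra hc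
    simp only [not_lt] at hc
    simp [hc] at hi
  have := hasPrefix_iff.1 h i hlt
  rw [this] at hi
  exact Option.some.inj hi

theorem HasPrefix.of_prefix {p : Cantor} {v w : List Bool} (h : p.HasPrefix w) (hv : v <+: w) :
    p.HasPrefix v := by
  obtain ⟨u, rfl⟩ := hv
  rw [hasPrefix_iff] at h ⊢
  intro i hi
  rw [← h i (by simp; omega), List.getElem?_append_left hi]

theorem HasPrefix.prefix_of_le {p : Cantor} {v w : List Bool} (hv : p.HasPrefix v)
    (hw : p.HasPrefix w) (h : v.length ≤ w.length) : v <+: w := by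
  have h1 := take_take p v.length w.length
  rw [min_eq_left h, hv, hw] at h1
  rw [← h1]
  exact List.take_prefix _ _

end Cantor

/-! ### Predicates that are semidecidable relative to an oracle -/

/-- Let each `t : T` come with an infinite sequence `o t`. A predicate `P t a` is semidecidable
relative to `o`, uniformly in `t` and in the discrete parameter `a`, if it holds exactly when a
primitive recursive test accepts some initial segment of `o t` together with `a`. Restricting the
inputs to a type `T` of situations of interest removes all domain conditions. The length of the
initial segment also serves as a bound for searches, so that primitive recursive tests suffice. -/
def Semidec {T A : Type*} [Primcodable A] (o : T → Cantor) (P : T → A → Prop) : Prop :=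
  ∃ R : List Bool × A → Prop, PrimrecPred R ∧ ∀ t a, P t a ↔ ∃ k, R ((o t).take k, a)

namespace Semidec

variable {T A B : Type*} [Primcodable A] [Primcodable B] {o : T → Cantor}

/-- The test can be chosen so that it accepts all extensions of an accepted initial segment. -/
theorem exists_mono {P : T → A → Prop} (h : Semidec o P) :
    ∃ R : List Bool × A → Prop, PrimrecPred R ∧
      (∀ (p : Cantor) (k k' : ℕ) (a : A), k ≤ k' → R (p.take k, a) → R (p.take k', a)) ∧
      ∀ t a, P t a ↔ ∃ k, R ((o t).take k, a) := by
  obtain ⟨R, hR, hP⟩ := h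
  refine ⟨fun x => ∃ j < x.1.length + 1, R (x.1.take j, x.2), ?_, ?_, ?_⟩
  · exact PrimrecPred.exists_fun_lt (f := fun x : List Bool × A => x.1.length + 1)
      (R := fun y => R (y.1.1.take y.2, y.1.2)) (by fun_prop) (hR.comp (by fun_prop))
  · rintro p k k' a hk ⟨j, hj, h⟩
    simp only [Cantor.length_take] at hj
    refine ⟨j, by simp; omega, ?_⟩
    simp only [Cantor.take_take] at h ⊢
    rwa [min_eq_left (by omega)] at h ⊢
  · intro t a
    rw [hP]
    constructor
    · rintro ⟨k, hk⟩
      exact ⟨k, k, by simp, by simpa [Cantor.take_take] using hk⟩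
    · rintro ⟨k, j, hj, h⟩
      rw [Cantor.take_take] at h
      exact ⟨_, h⟩

theorem of_primrecPred {S : A → Prop} (hS : PrimrecPred S) : Semidec o fun _ a => S a :=
  ⟨fun x => S x.2, hS.comp (by fun_prop), fun t a => by simp⟩

theorem congr {P Q : T → A → Prop} (h : Semidec o P) (hPQ : ∀ t a, Q t a ↔ P t a) :
    Semidec o Q := by
  obtain ⟨R, hR, hP⟩ := h
  exact ⟨R, hR, fun t a => by rw [hPQ, hP]⟩

theorem comp {P : T → A → Prop} (h : Semidec o P) {f : B → A} (hf : Primrec f) :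
    Semidec o fun t b => P t (f b) := by
  obtain ⟨R, hR, hP⟩ := h
  exact ⟨fun x => R (x.1, f x.2), hR.comp (by fun_prop), fun t b => hP t (f b)⟩

theorem and {P Q : T → A → Prop} (hP : Semidec o P) (hQ : Semidec o Q) :
    Semidec o fun t a => P t a ∧ Q t a := by
  obtain ⟨R, hR, mR, hP⟩ := hP.exists_mono
  obtain ⟨S, hS, mS, hQ⟩ := hQ.exists_mono
  refine ⟨fun x => R x ∧ S x, hR.and hS, fun t a => ?_⟩
  refine (and_congr (hP t a) (hQ t a)).trans ?_
  constructor
  · rintro ⟨⟨k, hk⟩, l, hl⟩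
    exact ⟨max k l, mR _ _ _ _ (le_max_left _ _) hk, mS _ _ _ _ (le_max_right _ _) hl⟩
  · rintro ⟨k, h1, h2⟩
    exact ⟨⟨k, h1⟩, k, h2⟩

theorem or {P Q : T → A → Prop} (hP : Semidec o P) (hQ : Semidec o Q) :
    Semidec o fun t a => P t a ∨ Q t a := by
  obtain ⟨R, hR, hP⟩ := hP
  obtain ⟨S, hS, hQ⟩ := hQ
  refine ⟨fun x => R x ∨ S x, hR.or hS, fun t a => ?_⟩
  exact (or_congr (hP t a) (hQ t a)).trans exists_or.symm

theorem ex {P : T → A → B → Prop} (h : Semidec o fun t (x : A × B) => P t x.1 x.2) :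
    Semidec o fun t a => ∃ b, P t a b := by
  obtain ⟨R, hR, mR, hP⟩ := h.exists_mono
  refine ⟨fun x => ∃ b ∈ (List.range x.1.length).filterMap (Encodable.decode (α := B)),
    R (x.1, (x.2, b)), ?_, fun t a => ?_⟩
  · refine PrimrecPred.exists_mem (R := fun y : (List Bool × A) × B => R (y.1.1, (y.1.2, y.2))) ?_
      (hR.comp (by fun_prop))
    exact Primrec.listFilterMap (f := fun x : List Bool × A => List.range x.1.length)
      (g := fun _ n => Encodable.decode n) (by fun_prop) (Primrec.decode.comp Primrec.snd)
  · constructor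
    · rintro ⟨b, hb⟩
      obtain ⟨k, hk⟩ := (hP t (a, b)).1 hb
      refine ⟨max k (Encodable.encode b + 1), b, ?_, mR _ _ _ _ (le_max_left _ _) hk⟩
      simp only [Cantor.length_take, List.mem_filterMap, List.mem_range]
      exact ⟨Encodable.encode b, by omega, Encodable.encodek b⟩
    · rintro ⟨k, b, -, h⟩
      exact ⟨b, (hP t (a, b)).2 ⟨k, h⟩⟩

theorem forall_lt {P : T → A → ℕ → Prop} (h : Semidec o fun t (x : A × ℕ) => P t x.1 x.2)
    {f : A → ℕ} (hf : Primrec f) : Semidec o fun t a => ∀ i < f a, P t a i := by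
  obtain ⟨R, hR, mR, hP⟩ := h.exists_mono
  refine ⟨fun x => ∀ i < f x.2, R (x.1, (x.2, i)), ?_, fun t a => ?_⟩
  · exact PrimrecPred.forall_fun_lt (f := fun x : List Bool × A => f x.2)
      (R := fun y : (List Bool × A) × ℕ => R (y.1.1, (y.1.2, y.2))) (by fun_prop)
      (hR.comp (by fun_prop))
  · have key : ∀ n, (∀ i < n, P t a i) ↔ ∃ k, ∀ i < n, R ((o t).take k, (a, i)) := by
      intro n
      constructor
      · intro hn
        induction n with
        | zero => exact ⟨0, by simp⟩
        | succ n ih =>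
          obtain ⟨k, hk⟩ := ih fun i hi => hn i (by omega)
          obtain ⟨l, hl⟩ := (hP t (a, n)).1 (hn n (by omega))
          refine ⟨max k l, fun i hi => ?_⟩
          rcases Nat.lt_succ_iff_lt_or_eq.1 hi with h | rfl
          · exact mR _ _ _ _ (le_max_left _ _) (hk i h)
          · exact mR _ _ _ _ (le_max_right _ _) hl
      · rintro ⟨k, hk⟩ i hi
        exact (hP t (a, i)).2 ⟨k, hk i hi⟩
    exact key (f a)

/-- Decidable properties of initial segments of the oracle are semidecidable, and so are their
negations. -/
theorem take {R : List Bool × A → Prop} (hR : PrimrecPred R) {f : A → ℕ} (hf : Primrec f) :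
    Semidec o fun t a => R ((o t).take (f a), a) := by
  refine ⟨fun x => f x.2 ≤ x.1.length ∧ R (x.1.take (f x.2), x.2), ?_, fun t a => ?_⟩
  · exact PrimrecPred.and (by fun_prop) (hR.comp (by fun_prop))
  · constructor
    · intro h
      exact ⟨f a, by simp, by simpa [Cantor.take_take] using h⟩
    · rintro ⟨k, hk, h⟩
      simp only [Cantor.length_take] at hk
      simpa [Cantor.take_take, hk] using h

end Semidec

/-- The function `f t a` with values in `ℕ` is computable from the oracle `o t`: its graph is
semidecidable. -/
def NatComputable {T A : Type*} [Primcodable A] (o : T → Cantor) (f : T → A → ℕ) : Prop :=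
  Semidec o fun t (x : A × ℕ) => f t x.1 = x.2

theorem NatComputable.comp {T A B : Type*} [Primcodable A] [Primcodable B] {o : T → Cantor}
    {f : T → A → ℕ} (hf : NatComputable o f) {g : B → A} (hg : Primrec g) :
    NatComputable o fun t b => f t (g b) :=
  Semidec.comp (f := fun x : B × ℕ => (g x.1, x.2)) hf (by fun_prop)

/-- Uniformization: a witness of a semidecidable predicate can be computed by searching for the
first one that is confirmed. -/
theorem Semidec.exists_natComputable {T A : Type*} [Primcodable A] {o : T → Cantor}
    {P : T → A → ℕ → Prop} (h : Semidec o fun t (x : A × ℕ) => P t x.1 x.2)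
    (hP : ∀ t a, ∃ m, P t a m) :
    ∃ f : T → A → ℕ, NatComputable o f ∧ ∀ t a, P t a (f t a) := by
  classical
  obtain ⟨R, hR, hPR⟩ := h
  let S : T → A → ℕ → Prop := fun t a s => R ((o t).take s.unpair.1, (a, s.unpair.2))
  have hS : ∀ t a, ∃ s, S t a s := by
    intro t a
    obtain ⟨m, hm⟩ := hP t a
    obtain ⟨k, hk⟩ := (hPR t (a, m)).1 hm
    exact ⟨Nat.pair k m, by simpa [S] using hk⟩
  have semi : Semidec o fun t (x : A × ℕ) => S t x.1 x.2 :=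
    Semidec.take (R := fun y : List Bool × (A × ℕ) => R (y.1, (y.2.1, y.2.2.unpair.2)))
      (f := fun x : A × ℕ => x.2.unpair.1) (hR.comp (by fun_prop)) (by fun_prop)
  have semi' : Semidec o fun t (x : A × ℕ) => ¬ S t x.1 x.2 :=
    Semidec.take (R := fun y : List Bool × (A × ℕ) => ¬ R (y.1, (y.2.1, y.2.2.unpair.2)))
      (f := fun x : A × ℕ => x.2.unpair.1) (hR.comp (by fun_prop)).not (by fun_prop)
  refine ⟨fun t a => (Nat.find (hS t a)).unpair.2, ?_, fun t a => ?_⟩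
  · have h1 : Semidec o fun t (x : A × ℕ) =>
        ∃ s : ℕ, S t x.1 s ∧ (∀ s' < s, ¬ S t x.1 s') ∧ s.unpair.2 = x.2 := by
      apply Semidec.ex (B := ℕ) (P := fun t (x : A × ℕ) s =>
        S t x.1 s ∧ (∀ s' < s, ¬ S t x.1 s') ∧ s.unpair.2 = x.2)
      refine (semi.comp (f := fun y : (A × ℕ) × ℕ => (y.1.1, y.2)) (by fun_prop)).and
        (Semidec.and ?_ (Semidec.of_primrecPred (by fun_prop)))
      exact Semidec.forall_lt (P := fun t (y : (A × ℕ) × ℕ) s' => ¬ S t y.1.1 s')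
        (semi'.comp (f := fun z : ((A × ℕ) × ℕ) × ℕ => (z.1.1.1, z.2)) (by fun_prop))
        (f := fun y => y.2) (by fun_prop)
    refine h1.congr fun t x => ?_
    constructor
    · intro hx
      exact ⟨Nat.find (hS t x.1), Nat.find_spec (hS t x.1), fun s' hs' => Nat.find_min _ hs', hx⟩
    · rintro ⟨s, h1, h2, h3⟩
      have h4 := (Nat.find_eq_iff (hS t x.1)).2 ⟨h1, h2⟩
      exact (congrArg (fun n => (Nat.unpair n).2) h4).trans h3
  · exact (hPR t (a, _)).2 ⟨_, Nat.find_spec (hS t a)⟩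

theorem Semidec.subst_nat {T A : Type*} [Primcodable A] {o : T → Cantor}
    {P : T → A → ℕ → Prop} (h : Semidec o fun t (x : A × ℕ) => P t x.1 x.2)
    {f : T → A → ℕ} (hf : NatComputable o f) : Semidec o fun t a => P t a (f t a) :=
  (Semidec.ex (P := fun t a m => f t a = m ∧ P t a m) (Semidec.and hf h)).congr fun t a => by simp

/-! ### Computable sequences -/

/-- The infinite sequence `Q t a` is computable from the oracle `o t`, uniformly in `t` and `a`. -/
def CantorComputable {T A : Type*} [Primcodable A] (o : T → Cantor) (Q : T → A → Cantor) : Prop :=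
  Semidec o fun t (x : A × ℕ × Bool) => Q t x.1 x.2.1 = x.2.2

namespace CantorComputable

variable {T A B : Type*} [Primcodable A] [Primcodable B] {o : T → Cantor}

theorem of_primrec {q : A → Cantor} (h : Primrec fun x : A × ℕ => q x.1 x.2) :
    CantorComputable o fun _ a => q a :=
  Semidec.of_primrecPred (PrimrecPred.fun_eq (h.comp (f := fun x => q x.1 x.2)
    (g := fun x : A × ℕ × Bool => (x.1, x.2.1)) (by fun_prop)) (by fun_prop))

theorem oracle : CantorComputable o fun t (_ : A) => o t := by
  refine (Semidec.take (R := fun x : List Bool × (A × ℕ × Bool) => x.1[x.2.2.1]? = some x.2.2.2)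
    (f := fun x => x.2.1 + 1) (by fun_prop) (by fun_prop)).congr fun t x => ?_
  simp only [Cantor.getElem?_take]
  simp

theorem congr {Q Q' : T → A → Cantor} (h : CantorComputable o Q) (hQ : ∀ t a, Q' t a = Q t a) :
    CantorComputable o Q' :=
  Semidec.congr h fun t x => by simp only [hQ]

/-- Reindexing both the parameter and the positions by primitive recursive functions. -/
theorem comp_index {Q : T → A → Cantor} (h : CantorComputable o Q) {f : B × ℕ → A} {g : B × ℕ → ℕ}
    (hf : Primrec f) (hg : Primrec g) :
    CantorComputable o fun t b n => Q t (f (b, n)) (g (b, n)) :=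
  Semidec.comp (f := fun x : B × ℕ × Bool => (f (x.1, x.2.1), g (x.1, x.2.1), x.2.2)) h
    ((hf.comp (g := fun x : B × ℕ × Bool => (x.1, x.2.1)) (by fun_prop)).pair
      ((hg.comp (g := fun x : B × ℕ × Bool => (x.1, x.2.1)) (by fun_prop)).pair (by fun_prop)))

theorem comp {Q : T → A → Cantor} (h : CantorComputable o Q) {f : B → A} (hf : Primrec f) :
    CantorComputable o fun t b => Q t (f b) :=
  h.comp_index (f := fun x : B × ℕ => f x.1) (by fun_prop) Primrec.snd

theorem ite {S : A × ℕ → Prop} [DecidablePred S] (hS : PrimrecPred S) {Q Q' : T → A → Cantor}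
    (h : CantorComputable o Q) (h' : CantorComputable o Q') :
    CantorComputable o fun t a n => if S (a, n) then Q t a n else Q' t a n := by
  have hS' : PrimrecPred fun x : A × ℕ × Bool => S (x.1, x.2.1) := hS.comp (by fun_prop)
  refine (((Semidec.of_primrecPred hS').and h).or
    ((Semidec.of_primrecPred hS'.not).and h')).congr fun t x => ?_
  by_cases hx : S (x.1, x.2.1) <;> simp [hx]

theorem pair {Q Q' : T → A → Cantor} (h : CantorComputable o Q) (h' : CantorComputable o Q') :
    CantorComputable o fun t a => Cantor.pair (Q t a) (Q' t a) :=
  ite (S := fun x => x.2 % 2 = 0) (by fun_prop)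
    (h.comp_index (f := fun x => x.1) (g := fun x => x.2 / 2) (by fun_prop) (by fun_prop))
    (h'.comp_index (f := fun x => x.1) (g := fun x => x.2 / 2) (by fun_prop) (by fun_prop))

theorem fst {Q Q' : T → A → Cantor}
    (h : CantorComputable o fun t a => Cantor.pair (Q t a) (Q' t a)) :
    CantorComputable o Q :=
  (h.comp_index (f := fun x => x.1) (g := fun x => 2 * x.2) (by fun_prop) (by fun_prop)).congr
    fun t a => by funext n; simp [Cantor.pair]

theorem snd {Q Q' : T → A → Cantor}
    (h : CantorComputable o fun t a => Cantor.pair (Q t a) (Q' t a)) :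
    CantorComputable o Q' :=
  (h.comp_index (f := fun x => x.1) (g := fun x => 2 * x.2 + 1) (by fun_prop) (by fun_prop)).congr
    fun t a => by
      funext n
      have h1 : (2 * n + 1) % 2 = 1 := by omega
      have h2 : (2 * n + 1) / 2 = n := by omega
      simp [Cantor.pair, h1, h2]

theorem append (w : List Bool) {Q : T → A → Cantor} (h : CantorComputable o Q) :
    CantorComputable o fun t a => Cantor.append w (Q t a) := by
  have hw : CantorComputable o fun (_ : T) (_ : A) => fun n => w[n]?.getD false :=
    of_primrec (q := fun _ n => w[n]?.getD false)
      (Primrec.option_getD.comp (by fun_prop) (by fun_prop))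
  refine (ite (S := fun x => x.2 < w.length) (by fun_prop) hw (h.comp_index (f := fun x => x.1)
    (g := fun x => x.2 - w.length) (by fun_prop) (by fun_prop))).congr fun t a => ?_
  funext n
  by_cases hn : n < w.length <;> simp [Cantor.append, hn]

theorem hasPrefix {Q : T → A → Cantor} (h : CantorComputable o Q) {w : A → List Bool}
    (hw : Primrec w) : Semidec o fun t a => (Q t a).HasPrefix (w a) := by
  have h1 : Semidec o fun t (x : A × ℕ) => ∃ b, Q t x.1 x.2 = b ∧ (w x.1)[x.2]? = some b :=
    Semidec.ex (P := fun t (x : A × ℕ) b => Q t x.1 x.2 = b ∧ (w x.1)[x.2]? = some b)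
      ((Semidec.comp (f := fun y : (A × ℕ) × Bool => (y.1.1, y.1.2, y.2)) h (by fun_prop)).and
        (Semidec.of_primrecPred (by fun_prop)))
  refine (Semidec.forall_lt (P := fun t a i => ∃ b, Q t a i = b ∧ (w a)[i]? = some b) h1
    (f := fun a => (w a).length) (by fun_prop)).congr fun t a => ?_
  simp [Cantor.hasPrefix_iff]

end CantorComputable

/-! ### Programs -/

namespace Cantor

open Nat.Partrec (Code)

/-- The outputs of a program on the initial segments of its input determine its output sequence
symbol by symbol. -/
theorem Transforms.apply_eq_iff {c : Code} {p q : Cantor} (h : Transforms c p q) (j : ℕ)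
    (b : Bool) : q j = b ↔ ∃ (w v : List Bool) (s : ℕ), p.HasPrefix w ∧
      Code.evaln s c (Encodable.encode w) = some (Encodable.encode v) ∧ v[j]? = some b := by
  constructor
  · intro hb
    obtain ⟨k, v, hv, hl⟩ := h.2 (j + 1)
    obtain ⟨s, hs⟩ := Code.evaln_complete.1 hv
    refine ⟨p.take k, v, s, hasPrefix_take _ _, hs, ?_⟩
    rw [hasPrefix_iff.1 (h.1 k v hv) j (by omega), hb]
  · rintro ⟨w, v, s, hw, hs, hj⟩
    refine (h.1 w.length v ?_).getElem? hj
    rw [hw]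
    exact Code.evaln_sound hs

end Cantor

open Nat.Partrec (Code)

theorem NatComputable.of_primrec {T A : Type*} [Primcodable A] {o : T → Cantor} {f : A → ℕ}
    (hf : Primrec f) : NatComputable o fun _ a => f a :=
  Semidec.of_primrecPred (S := fun x : A × ℕ => f x.1 = x.2) (by fun_prop)

/-- Relative computability is closed under the application of programs. -/
theorem CantorComputable.of_transforms {T A : Type*} [Primcodable A] {o : T → Cantor}
    {Q Z : T → A → Cantor} (hQ : CantorComputable o Q) {c : T → A → ℕ} (hc : NatComputable o c)
    (h : ∀ t a, Cantor.Transforms (Denumerable.ofNat Code (c t a)) (Q t a) (Z t a)) :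
    CantorComputable o Z := by
  let D : T → A × ℕ × Bool → ℕ → List Bool × List Bool × ℕ → Prop := fun t x m y =>
    (Q t x.1).HasPrefix y.1 ∧ Code.evaln y.2.2 (Denumerable.ofNat Code m) (Encodable.encode y.1) =
      some (Encodable.encode y.2.1) ∧ y.2.1[x.2.1]? = some x.2.2
  have h1 : Semidec o fun t (x : (A × ℕ × Bool) × ℕ) => ∃ y, D t x.1 x.2 y := by
    refine Semidec.ex (P := fun t (x : (A × ℕ × Bool) × ℕ) y => D t x.1 x.2 y)
      (Semidec.and ?_ (Semidec.of_primrecPred ?_))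
    · exact (hQ.comp (f := fun z : ((A × ℕ × Bool) × ℕ) × (List Bool × List Bool × ℕ) => z.1.1.1)
        (by fun_prop)).hasPrefix (w := fun z => z.2.1) (by fun_prop)
    · have h2 : Primrec fun z : ((A × ℕ × Bool) × ℕ) × (List Bool × List Bool × ℕ) =>
          Denumerable.ofNat Code z.1.2 := (Primrec.ofNat Code).comp (by fun_prop)
      have h3 := Code.primrec_evaln.comp
        (g := fun z : ((A × ℕ × Bool) × ℕ) × (List Bool × List Bool × ℕ) =>
          ((z.2.2.2, Denumerable.ofNat Code z.1.2), Encodable.encode z.2.1)) (by fun_prop)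
      fun_prop
  refine Semidec.congr (h1.subst_nat (P := fun t x m => ∃ y, D t x m y)
    (hc.comp (g := fun x : A × ℕ × Bool => x.1) (by fun_prop))) fun t x => ?_
  rw [(h t x.1).apply_eq_iff]
  constructor
  · rintro ⟨w, v, s, h⟩
    exact ⟨(w, v, s), h⟩
  · rintro ⟨⟨w, v, s⟩, h⟩
    exact ⟨w, v, s, h⟩

/-- The universal program: the value at `y` of the partial function with name `p` is computable
from `p` and `y`. -/
theorem CantorComputable.of_eta {T A : Type*} [Primcodable A] {o : T → Cantor}
    {P Y Z : T → A → Cantor} (hP : CantorComputable o P) (hY : CantorComputable o Y)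
    (h : ∀ t a, Cantor.Eta (P t a) (Y t a) (Z t a)) : CantorComputable o Z := by
  choose n r hp htr using h
  -- The index of the program is found by searching for the initial segment `0ⁿ 1` of the name.
  have pre : ∀ t a m, (P t a).HasPrefix (List.replicate m false ++ [true]) ↔ m = n t a := by
    intro t a m
    have at_lt : ∀ i < n t a, P t a i = false := by
      intro i hi
      rw [hp]
      simp only [Cantor.append, List.length_append, List.length_replicate, List.length_singleton]
      rw [dif_pos (by omega), List.getElem_append_left (by simpa using hi)]
      simp
    have at_n : P t a (n t a) = true := by
      rw [hp]
      simp [Cantor.append]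
    constructor
    · intro hm
      have hm_lt : ∀ i < m, P t a i = false := fun i hi => hm.getElem? (by
        rw [List.getElem?_append_left (by simpa using hi)]; simp [hi])
      have hm_m : P t a m = true := hm.getElem? (by simp)
      rcases lt_trichotomy m (n t a) with hlt | heq | hgt
      · simp [at_lt m hlt] at hm_m
      · exact heq
      · simp [hm_lt _ hgt] at at_n
    · rintro rfl
      rw [Cantor.hasPrefix_iff]
      intro i hi
      simp only [List.length_append, List.length_replicate, List.length_singleton] at hi
      rcases Nat.lt_succ_iff_lt_or_eq.1 hi with h1 | rfl
      · rw [at_lt i h1, List.getElem?_append_left (by simpa using h1)]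
        simp [h1]
      · rw [at_n]
        simp
  have hn : NatComputable o n :=
    Semidec.congr ((hP.comp (f := fun x : A × ℕ => x.1) (by fun_prop)).hasPrefix
      (w := fun x => List.replicate x.2 false ++ [true]) (by fun_prop))
      fun t x => by rw [pre]; exact eq_comm
  have hr : CantorComputable o r := by
    refine Semidec.congr (Semidec.subst_nat
      (P := fun t (x : A × ℕ × Bool) m => P t x.1 (m + 1 + x.2.1) = x.2.2)
      (Semidec.comp (f := fun x : (A × ℕ × Bool) × ℕ => (x.1.1, x.2 + 1 + x.1.2.1, x.1.2.2)) hP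
        (by fun_prop)) (hn.comp (g := fun x : A × ℕ × Bool => x.1) (by fun_prop))) fun t x => ?_
    rw [hp t x.1]
    have h1 : ¬ n t x.1 + 1 + x.2.1 < n t x.1 + 1 := by omega
    simp only [Cantor.append, List.length_append, List.length_replicate, List.length_singleton,
      dif_neg h1, Nat.add_sub_cancel_left]
  exact (hr.pair hY).of_transforms hn htr

/-- A sequence that is uniformly computable from an oracle is the output of a single program. -/
theorem CantorComputable.exists_code {T : Type*} {o : T → Cantor} {Q : T → Unit → Cantor}
    (hQ : CantorComputable o Q) : ∃ c : Code, ∀ t, Cantor.Transforms c (o t) (Q t ()) := by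
  classical
  obtain ⟨R, hR, hQR⟩ := (hQ.comp (f := fun _ : List Bool => ()) (Primrec.const ())).hasPrefix
    Primrec.id
  simp only [id] at hQR
  -- The length of the input codes a guess `(k, v)`, which is written if it is confirmed by the
  -- first `k` symbols of the input; otherwise nothing is written.
  let G : List Bool → Option (List Bool) := fun w =>
    (Encodable.decode (α := List Bool) w.length.unpair.2).bind fun v =>
      if R (w.take w.length.unpair.1, v) then some v else none
  have hG : Primrec G := by
    refine Primrec.option_bind (f := fun w : List Bool =>
      Encodable.decode (α := List Bool) w.length.unpair.2)
      (Primrec.decode.comp (by fun_prop)) ?_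
    exact Primrec.ite (hR.comp (f := fun x : List Bool × List Bool =>
      (x.1.take x.1.length.unpair.1, x.2)) (by fun_prop)) (by fun_prop) (Primrec.const none)
  have hGtake : ∀ t k v, G ((o t).take k) = some v → (Q t ()).HasPrefix v := by
    intro t k v h
    simp only [G, Option.bind_eq_some_iff] at h
    obtain ⟨u, -, hu⟩ := h
    split_ifs at hu with hRu
    obtain rfl := Option.some.inj hu
    rw [Cantor.take_take] at hRu
    exact (hQR t u).2 ⟨_, hRu⟩
  have hpart : Nat.Partrec fun n => ((Encodable.decode (α := List Bool) n).bind G).map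
      Encodable.encode := by
    have h1 : Primrec fun n : ℕ => (Encodable.decode (α := List Bool) n).bind G :=
      Primrec.option_bind Primrec.decode (hG.comp Primrec.snd)
    have h2 := Primrec.option_map h1 (g := fun _ w => Encodable.encode w)
      (Primrec.encode.comp Primrec.snd)
    exact Partrec.nat_iff.1 h2.to_comp.ofOption
  obtain ⟨c, hc⟩ := Code.exists_code.1 hpart
  have hmem : ∀ t k v, Encodable.encode v ∈ c.eval (Encodable.encode ((o t).take k)) ↔
      G ((o t).take k) = some v := by
    intro t k v
    rw [hc]
    simp [Encodable.encodek]
  refine ⟨c, fun t => ⟨fun k v hv => hGtake t k v ((hmem t k v).1 hv), fun m => ?_⟩⟩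
  obtain ⟨k, hk⟩ := (hQR t ((Q t ()).take m)).1 (Cantor.hasPrefix_take _ _)
  have hle : k ≤ Nat.pair k (Encodable.encode ((Q t ()).take m)) := Nat.left_le_pair _ _
  refine ⟨Nat.pair k (Encodable.encode ((Q t ()).take m)), (Q t ()).take m, ?_, by simp⟩
  rw [hmem]
  simp [G, Cantor.take_take, min_eq_left hle, hk, Encodable.encodek]

/-- Computability of a function between represented spaces, in terms of relative computability. -/
theorem ComputableFunOn.of_cantorComputable {X Y : Type*} {δ : TTERep X} {δ' : TTERep Y}
    {f : X → Y} {S : Set X}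
    {Q : {t : Cantor × X // δ t.1 t.2 ∧ t.2 ∈ S} → Unit → Cantor}
    (hQ : CantorComputable (fun t => t.1.1) Q) (h : ∀ t, δ' (Q t ()) (f t.1.2)) :
    ComputableFunOn δ δ' f S := by
  obtain ⟨c, hc⟩ := hQ.exists_code
  exact ⟨c, fun p x hp hx => ⟨Q ⟨(p, x), hp, hx⟩ (), hc ⟨(p, x), hp, hx⟩, h _⟩⟩

/-- Names in a function space are obtained from programs that take the oracle `r` as a parameter:
there is a word `w` such that `w r` names every function whose values are uniformly computable
from `r` and the argument. -/
theorem CantorComputable.exists_func_name {I X Y : Type*} {δ : TTERep X} {δ' : TTERep Y}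
    {r : I → Cantor} {f : I → X → Y}
    {Q : {t : I × Cantor × X // δ t.2.1 t.2.2} → Unit → Cantor}
    (hQ : CantorComputable (fun t => Cantor.pair (r t.1.1) t.1.2.1) Q)
    (h : ∀ t, δ' (Q t ()) (f t.1.1 t.1.2.2)) :
    ∃ w : List Bool, ∀ i, TTERep.func δ δ' (Cantor.append w (r i)) (f i) := by
  obtain ⟨c, hc⟩ := hQ.exists_code
  refine ⟨List.replicate (Encodable.encode c) false ++ [true], fun i y x hy => ?_⟩
  refine ⟨Q ⟨(i, y, x), hy⟩ (), ⟨Encodable.encode c, r i, rfl, ?_⟩, h ⟨(i, y, x), hy⟩⟩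
  rw [Denumerable.ofNat_encode]
  exact hc ⟨(i, y, x), hy⟩

/-! ### Cauchy names -/

/-- The word `0 1^{n₀ + 1} 0 1^{n₁ + 1} … 0 1^{n_{k-1} + 1}` for a list `n₀, …, n_{k-1}`. -/
def listWord (l : List ℕ) : List Bool := l.flatMap fun m => false :: List.replicate (m + 1) true

theorem primrec_listWord : Primrec listWord :=
  Primrec.list_flatMap (f := fun l : List ℕ => l)
    (g := fun _ m => false :: List.replicate (m + 1) true) Primrec.id (by
      unfold Primrec₂
      fun_prop)

theorem cauchyWord_eq_listWord (n : ℕ → ℕ) (k : ℕ) :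
    TTERep.cauchyWord n k = listWord ((List.range k).map n) := by
  simp [TTERep.cauchyWord, listWord, List.flatMap_map]

theorem listWord_prefix_listWord {l l' : List ℕ} (h : l <+: l') : listWord l <+: listWord l' := by
  obtain ⟨u, rfl⟩ := h
  simp [listWord, List.flatMap_append]

theorem length_le_length_listWord (l : List ℕ) : l.length ≤ (listWord l).length := by
  induction l with
  | nil => simp
  | cons m l ih =>
    simp only [listWord, List.flatMap_cons, List.length_append, List.length_cons] at ih ⊢
    omega

theorem getElem?_eq_of_prefix {B : Type*} {v w : List B} (h : v <+: w) {i : ℕ}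
    (hi : i < v.length) : w[i]? = v[i]? := by
  obtain ⟨u, rfl⟩ := h
  exact List.getElem?_append_left hi

theorem range_map_prefix (n : ℕ → ℕ) {k k' : ℕ} (h : k ≤ k') :
    (List.range k).map n <+: (List.range k').map n := by
  obtain ⟨d, rfl⟩ := Nat.exists_eq_add_of_le h
  rw [List.range_add, List.map_append]
  exact List.prefix_append _ _

/-- A maximal block of ones inside a word can be read off from every longer word. -/
theorem replicate_true_prefix {a b : ℕ} {x y : List Bool}
    (hy : y = [] ∨ ∃ y', y = false :: y')
    (h : List.replicate a true ++ false :: x <+: List.replicate b true ++ y) :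
    a = b ∧ false :: x <+: y := by
  induction a generalizing b with
  | zero =>
    cases b with
    | zero => exact ⟨rfl, by simpa using h⟩
    | succ b => simp [List.replicate_succ] at h
  | succ a ih =>
    cases b with
    | zero => rcases hy with rfl | ⟨y', rfl⟩ <;> simp [List.replicate_succ] at h
    | succ b =>
      simp only [List.replicate_succ, List.cons_append, List.cons_prefix_cons, true_and] at h
      obtain ⟨h1, h2⟩ := ih h
      exact ⟨by rw [h1], h2⟩

theorem listWord_eq_nil_or (l : List ℕ) : listWord l = [] ∨ ∃ y, listWord l = false :: y := by
  cases l with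
  | nil => exact Or.inl rfl
  | cons m l => exact Or.inr ⟨_, by simp [listWord]; rfl⟩

/-- A word followed by a zero can be decoded unambiguously. -/
theorem prefix_of_listWord_append_prefix {l l' : List ℕ}
    (h : listWord l ++ [false] <+: listWord l') : l <+: l' := by
  induction l generalizing l' with
  | nil => exact List.nil_prefix
  | cons m l ih =>
    cases l' with
    | nil => simp [listWord] at h
    | cons m' l' =>
      have e1 : listWord (m :: l) ++ [false] =
          false :: (List.replicate (m + 1) true ++ (listWord l ++ [false])) := by
        simp [listWord]
      have e2 : listWord (m' :: l') = false :: (List.replicate (m' + 1) true ++ listWord l') := by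
        simp [listWord]
      obtain ⟨x, hx⟩ : ∃ x, listWord l ++ [false] = false :: x := by
        rcases listWord_eq_nil_or l with h0 | ⟨y, hy⟩
        · exact ⟨[], by simp [h0]⟩
        · exact ⟨y ++ [false], by simp [hy]⟩
      rw [e1, e2, List.cons_prefix_cons, hx] at h
      obtain ⟨h1, h2⟩ := replicate_true_prefix (listWord_eq_nil_or l') h.2
      rw [← hx] at h2
      obtain rfl : m = m' := by omega
      exact List.cons_prefix_cons.2 ⟨rfl, ih h2⟩

/-- A sequence of natural numbers is computable from the infinite word that encodes it. -/
theorem NatComputable.of_cauchyWord {T A : Type*} [Primcodable A] {o : T → Cantor}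
    {Q : T → A → Cantor} (hQ : CantorComputable o Q) {n : T → A × ℕ → ℕ}
    (h : ∀ t a k, (Q t a).HasPrefix (TTERep.cauchyWord (fun i => n t (a, i)) k)) :
    NatComputable o n := by
  refine Semidec.congr (Semidec.ex (P := fun t (x : (A × ℕ) × ℕ) (l : List ℕ) =>
    (Q t x.1.1).HasPrefix (listWord l ++ [false]) ∧ l[x.1.2]? = some x.2)
    (Semidec.and ?_ (Semidec.of_primrecPred (by fun_prop)))) fun t x => ?_
  · have := primrec_listWord
    exact (hQ.comp (f := fun y : ((A × ℕ) × ℕ) × List ℕ => y.1.1.1) (by fun_prop)).hasPrefix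
      (w := fun y => listWord y.2 ++ [false]) (by fun_prop)
  · obtain ⟨⟨a, i⟩, m⟩ := x
    have h' : ∀ k, (Q t a).HasPrefix (listWord ((List.range k).map fun i => n t (a, i))) :=
      fun k => by rw [← cauchyWord_eq_listWord]; exact h t a k
    constructor
    · intro hm
      refine ⟨(List.range (i + 1)).map fun i => n t (a, i), (h' (i + 2)).of_prefix ?_, ?_⟩
      · rw [List.range_succ (n := i + 1)]
        simp [listWord]
      · simpa using hm
    · rintro ⟨l, hl, hi⟩
      have hle := length_le_length_listWord
        ((List.range (listWord l ++ [false]).length).map fun i => n t (a, i))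
      simp only [List.length_map, List.length_range] at hle
      have h1 := prefix_of_listWord_append_prefix (hl.prefix_of_le (h' _) hle)
      have hlt : i < l.length := by
        by_contra hc
        simp only [not_lt] at hc
        simp [hc] at hi
      have h2 := getElem?_eq_of_prefix h1 hlt
      have hlt' := hlt.trans_le h1.length_le
      rw [hi, List.getElem?_eq_getElem hlt'] at h2
      simpa using h2

/-- A computable sequence of natural numbers can be written as an infinite word. -/
theorem NatComputable.exists_cauchyWord {T A : Type*} [Primcodable A] {o : T → Cantor}
    {n : T → A × ℕ → ℕ} (hn : NatComputable o n) :
    ∃ Q : T → A → Cantor, CantorComputable o Q ∧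
      ∀ t a k, (Q t a).HasPrefix (TTERep.cauchyWord (fun i => n t (a, i)) k) := by
  let W : T → A → ℕ → List Bool := fun t a k => listWord ((List.range k).map fun i => n t (a, i))
  have hlen : ∀ t a k, k ≤ (W t a k).length := fun t a k => by
    simpa using length_le_length_listWord ((List.range k).map fun i => n t (a, i))
  let Q : T → A → Cantor := fun t a j => (W t a (j + 1))[j]?.getD false
  have hQW : ∀ t a k, (Q t a).HasPrefix (W t a k) := by
    intro t a k
    rw [Cantor.hasPrefix_iff]
    intro i hi
    have h1 : i < (W t a (i + 1)).length := hlen t a (i + 1)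
    have h2 : (W t a k)[i]? = (W t a (i + 1))[i]? := by
      rcases le_total k (i + 1) with h | h
      · exact (getElem?_eq_of_prefix (listWord_prefix_listWord (range_map_prefix _ h)) hi).symm
      · exact getElem?_eq_of_prefix (listWord_prefix_listWord (range_map_prefix _ h)) h1
    rw [h2]
    simp [Q, h1]
  refine ⟨Q, ?_, fun t a k => by rw [cauchyWord_eq_listWord]; exact hQW t a k⟩
  have hl : Semidec o fun t (x : (A × ℕ × Bool) × List ℕ) =>
      ∀ i < x.2.length, ∃ m, n t (x.1.1, i) = m ∧ x.2[i]? = some m := by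
    refine Semidec.forall_lt (P := fun t (x : (A × ℕ × Bool) × List ℕ) i =>
      ∃ m, n t (x.1.1, i) = m ∧ x.2[i]? = some m) (f := fun x => x.2.length) ?_ (by fun_prop)
    refine Semidec.ex (P := fun t (y : ((A × ℕ × Bool) × List ℕ) × ℕ) m =>
      n t (y.1.1.1, y.2) = m ∧ y.1.2[y.2]? = some m)
      (Semidec.and ?_ (Semidec.of_primrecPred (by fun_prop)))
    exact Semidec.comp (f := fun z : (((A × ℕ × Bool) × List ℕ) × ℕ) × ℕ =>
      ((z.1.1.1.1, z.1.2), z.2)) hn (by fun_prop)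
  have := primrec_listWord
  refine Semidec.congr (Semidec.ex (P := fun t (x : A × ℕ × Bool) (l : List ℕ) =>
    (∀ i < l.length, ∃ m, n t (x.1, i) = m ∧ l[i]? = some m) ∧
      (listWord l)[x.2.1]? = some x.2.2) (hl.and (Semidec.of_primrecPred (by fun_prop))))
      fun t x => ?_
  obtain ⟨a, j, b⟩ := x
  constructor
  · intro hb
    refine ⟨(List.range (j + 1)).map fun i => n t (a, i), by simp +contextual, ?_⟩
    rw [← hb]
    exact Cantor.hasPrefix_iff.1 (hQW t a (j + 1)) j (hlen t a (j + 1))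
  · rintro ⟨l, h1, h2⟩
    have hl : l = (List.range l.length).map fun i => n t (a, i) := by
      apply List.ext_getElem?
      intro i
      by_cases hi : i < l.length
      · obtain ⟨m, h3, h4⟩ := h1 i hi
        rw [h4]
        simp [hi, h3]
      · simp [hi]
    rw [hl] at h2
    exact (hQW t a l.length).getElem? h2

/-- Names of `x t a` are computable if close members of the dense sequence can be found by search.
The error bound `2⁻ⁱ⁻¹` leaves room for the required distances between different members. -/
theorem CantorComputable.exists_cauchy_name {T A X : Type*} [Primcodable A] [MetricSpace X]
    {o : T → Cantor} {α : ℕ → X} {x : T → A → X} {P : T → A × ℕ → ℕ → Prop}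
    (hP : Semidec o fun t (y : (A × ℕ) × ℕ) => P t y.1 y.2) (hex : ∀ t y, ∃ m, P t y m)
    (hdist : ∀ t a i m, P t (a, i) m → dist (α m) (x t a) < 2⁻¹ ^ (i + 1)) :
    ∃ Q : T → A → Cantor, CantorComputable o Q ∧ ∀ t a, TTERep.cauchy α (Q t a) (x t a) := by
  obtain ⟨n, hn, hPn⟩ := hP.exists_natComputable hex
  obtain ⟨Q, hQ, hword⟩ := hn.exists_cauchyWord
  refine ⟨Q, hQ, fun t a => ⟨fun i => n t (a, i), hword t a, fun i j hij => ?_, ?_⟩⟩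
  · have h1 := hdist t a i _ (hPn t (a, i))
    have h2 := hdist t a j _ (hPn t (a, j))
    have h3 : (2⁻¹ : ℝ) ^ (j + 1) ≤ 2⁻¹ ^ (i + 1) :=
      pow_le_pow_of_le_one (by norm_num) (by norm_num) (by omega)
    have h4 : (2⁻¹ : ℝ) ^ i = 2⁻¹ ^ (i + 1) + 2⁻¹ ^ (i + 1) := by ring
    linarith [dist_triangle_right (α (n t (a, i))) (α (n t (a, j))) (x t a)]
  · rw [tendsto_iff_dist_tendsto_zero]
    refine squeeze_zero (fun _ => dist_nonneg) (fun i => (hdist t a i _ (hPn t (a, i))).le) ?_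
    exact (tendsto_pow_atTop_nhds_zero_of_lt_one (by norm_num) (by norm_num)).comp
      (Filter.tendsto_add_atTop_nat 1)

/-- The point `x t a` of a metric space with a dense sequence `α` is computable from the oracle
`o t`, uniformly in `t` and `a`: members of `α` that approximate it up to `2⁻ⁱ` are computable. -/
def PointComputable {T A X : Type*} [Primcodable A] [MetricSpace X] (α : ℕ → X) (o : T → Cantor)
    (x : T → A → X) : Prop :=
  ∃ n : T → A × ℕ → ℕ, NatComputable o n ∧ ∀ t a i, dist (α (n t (a, i))) (x t a) ≤ 2⁻¹ ^ i

/-- A point is computable from its names. -/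
theorem PointComputable.of_name {T A X : Type*} [Primcodable A] [MetricSpace X]
    {o : T → Cantor} {α : ℕ → X} {x : T → A → X} {Q : T → A → Cantor}
    (hQ : CantorComputable o Q) (h : ∀ t a, TTERep.cauchy α (Q t a) (x t a)) :
    PointComputable α o x := by
  choose n hn hdist hlim using h
  refine ⟨fun t y => n t y.1 y.2, NatComputable.of_cauchyWord hQ hn, fun t a i => ?_⟩
  refine le_of_tendsto (tendsto_const_nhds.dist (hlim t a)) ?_
  filter_upwards [Filter.eventually_gt_atTop i] with j hj
  exact (hdist t a i j hj).le

/-! ### Rational arithmetic on indices -/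

namespace TTERep

/-- An index of the sum of two rational numbers. -/
def addIndex (r s : ℕ) : ℕ :=
  Nat.pair (r.unpair.1 * (s.unpair.2.unpair.2 + 1) + s.unpair.1 * (r.unpair.2.unpair.2 + 1))
    (Nat.pair (r.unpair.2.unpair.1 * (s.unpair.2.unpair.2 + 1) +
        s.unpair.2.unpair.1 * (r.unpair.2.unpair.2 + 1))
      (r.unpair.2.unpair.2 * s.unpair.2.unpair.2 + r.unpair.2.unpair.2 + s.unpair.2.unpair.2))

/-- An index of the product of two rational numbers. -/
def mulIndex (r s : ℕ) : ℕ :=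
  Nat.pair (r.unpair.1 * s.unpair.1 + r.unpair.2.unpair.1 * s.unpair.2.unpair.1)
    (Nat.pair (r.unpair.1 * s.unpair.2.unpair.1 + r.unpair.2.unpair.1 * s.unpair.1)
      (r.unpair.2.unpair.2 * s.unpair.2.unpair.2 + r.unpair.2.unpair.2 + s.unpair.2.unpair.2))

/-- An index of the negative of a rational number. -/
def negIndex (r : ℕ) : ℕ :=
  Nat.pair r.unpair.2.unpair.1 (Nat.pair r.unpair.1 r.unpair.2.unpair.2)

/-- An index of `2⁻ⁱ`. -/
def invPowIndex (i : ℕ) : ℕ := Nat.pair 1 (Nat.pair 0 (2 ^ i - 1))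

theorem alphaReal_addIndex (r s : ℕ) :
    alphaReal (addIndex r s) = alphaReal r + alphaReal s := by
  simp only [alphaReal, addIndex, Nat.unpair_pair]
  have h1 : (r.unpair.2.unpair.2 : ℝ) + 1 ≠ 0 := by positivity
  have h2 : (s.unpair.2.unpair.2 : ℝ) + 1 ≠ 0 := by positivity
  push_cast
  rw [div_add_div _ _ h1 h2]
  congr 1 <;> ring

theorem alphaReal_mulIndex (r s : ℕ) :
    alphaReal (mulIndex r s) = alphaReal r * alphaReal s := by
  simp only [alphaReal, mulIndex, Nat.unpair_pair]
  push_cast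
  rw [div_mul_div_comm]
  congr 1 <;> ring

theorem alphaReal_negIndex (r : ℕ) : alphaReal (negIndex r) = -alphaReal r := by
  simp only [alphaReal, negIndex, Nat.unpair_pair]
  rw [← neg_div]
  congr 1; ring

theorem alphaReal_invPowIndex (i : ℕ) : alphaReal (invPowIndex i) = 2⁻¹ ^ i := by
  have h : 1 ≤ 2 ^ i := Nat.one_le_two_pow
  simp [alphaReal, invPowIndex, Nat.cast_sub h]

theorem alphaReal_zero : alphaReal 0 = 0 := by
  simp [alphaReal]

theorem alphaComplex_re (m : ℕ) : (alphaComplex m).re = alphaReal m.unpair.1 := by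
  simp [alphaComplex]

theorem alphaComplex_im (m : ℕ) : (alphaComplex m).im = alphaReal m.unpair.2 := by
  simp [alphaComplex]

theorem alphaReal_lt_iff (r s : ℕ) : alphaReal r < alphaReal s ↔
    r.unpair.1 * (s.unpair.2.unpair.2 + 1) + s.unpair.2.unpair.1 * (r.unpair.2.unpair.2 + 1) <
    s.unpair.1 * (r.unpair.2.unpair.2 + 1) + r.unpair.2.unpair.1 * (s.unpair.2.unpair.2 + 1) := by
  rw [alphaReal, alphaReal, div_lt_div_iff₀ (by positivity) (by positivity),
    ← Nat.cast_lt (α := ℝ)]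
  push_cast
  constructor <;> intro h <;> nlinarith

theorem exists_alphaReal_eq (q : ℚ) : ∃ m, alphaReal m = q := by
  refine ⟨Nat.pair q.num.toNat (Nat.pair (-q.num).toNat (q.den - 1)), ?_⟩
  simp only [alphaReal, Nat.unpair_pair]
  have h1 : ((q.num.toNat : ℝ)) - ((-q.num).toNat : ℝ) = (q.num : ℝ) := by
    have : ((q.num.toNat : ℤ)) - ((-q.num).toNat : ℤ) = q.num := by omega
    exact_mod_cast this
  have h2 : (((q.den - 1 : ℕ) : ℝ)) + 1 = q.den := by
    have : (q.den - 1) + 1 = q.den := Nat.sub_add_cancel q.den_pos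
    exact_mod_cast this
  rw [h1, h2, Rat.cast_def]

theorem exists_alphaReal_btwn {a b : ℝ} (h : a < b) : ∃ m, a < alphaReal m ∧ alphaReal m < b := by
  obtain ⟨q, h1, h2⟩ := exists_rat_btwn h
  obtain ⟨m, hm⟩ := exists_alphaReal_eq q
  exact ⟨m, by rwa [hm], by rwa [hm]⟩

section

variable {A : Type*} [Primcodable A] {f g : A → ℕ}

@[fun_prop]
theorem primrec_addIndex (hf : Primrec f) (hg : Primrec g) :
    Primrec fun a => addIndex (f a) (g a) := by
  unfold addIndex
  fun_prop

@[fun_prop]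
theorem primrec_mulIndex (hf : Primrec f) (hg : Primrec g) :
    Primrec fun a => mulIndex (f a) (g a) := by
  unfold mulIndex
  fun_prop

@[fun_prop]
theorem primrec_negIndex (hf : Primrec f) : Primrec fun a => negIndex (f a) := by
  unfold negIndex
  fun_prop

@[fun_prop]
theorem primrec_invPowIndex (hf : Primrec f) : Primrec fun a => invPowIndex (f a) := by
  unfold invPowIndex
  fun_prop

theorem primrecPred_alphaReal_lt (hf : Primrec f) (hg : Primrec g) :
    PrimrecPred fun a => alphaReal (f a) < alphaReal (g a) := by
  simp only [alphaReal_lt_iff]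
  fun_prop

end

end TTERep

/-! ### Computable real numbers -/

open TTERep (alphaReal addIndex mulIndex negIndex invPowIndex)

/-- The real number `X t a` is computable from the oracle `o t`, uniformly in `t` and `a`: both of
its cuts in the rational numbers are semidecidable. -/
def RealComputable {T A : Type*} [Primcodable A] (o : T → Cantor) (X : T → A → ℝ) : Prop :=
  (Semidec o fun t (x : A × ℕ) => alphaReal x.2 < X t x.1) ∧
    Semidec o fun t (x : A × ℕ) => X t x.1 < alphaReal x.2

namespace RealComputable

variable {T A B : Type*} [Primcodable A] [Primcodable B] {o : T → Cantor} {X Y : T → A → ℝ}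

theorem congr (hX : RealComputable o X) (h : ∀ t a, Y t a = X t a) : RealComputable o Y :=
  ⟨hX.1.congr fun t x => by rw [h], hX.2.congr fun t x => by rw [h]⟩

theorem comp (hX : RealComputable o X) {f : B → A} (hf : Primrec f) :
    RealComputable o fun t b => X t (f b) :=
  ⟨hX.1.comp (f := fun x : B × ℕ => (f x.1, x.2)) (by fun_prop),
    hX.2.comp (f := fun x : B × ℕ => (f x.1, x.2)) (by fun_prop)⟩

theorem lt (hX : RealComputable o X) (hY : RealComputable o Y) :
    Semidec o fun t a => X t a < Y t a := by
  refine (Semidec.ex (P := fun t a m => X t a < alphaReal m ∧ alphaReal m < Y t a)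
    (hX.2.and hY.1)).congr fun t a => ?_
  exact ⟨TTERep.exists_alphaReal_btwn, fun ⟨m, h1, h2⟩ => h1.trans h2⟩

theorem alphaReal {f : A → ℕ} (hf : Primrec f) :
    RealComputable o fun (_ : T) a => alphaReal (f a) :=
  ⟨Semidec.of_primrecPred (S := fun x : A × ℕ => TTERep.alphaReal x.2 < TTERep.alphaReal (f x.1))
      (TTERep.primrecPred_alphaReal_lt (by fun_prop) (by fun_prop)),
    Semidec.of_primrecPred (S := fun x : A × ℕ => TTERep.alphaReal (f x.1) < TTERep.alphaReal x.2)
      (TTERep.primrecPred_alphaReal_lt (by fun_prop) (by fun_prop))⟩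

theorem inv_two_pow {f : A → ℕ} (hf : Primrec f) :
    RealComputable o fun (_ : T) a => (2⁻¹ : ℝ) ^ f a :=
  (alphaReal (f := fun a => invPowIndex (f a)) (by fun_prop)).congr
    fun t a => (TTERep.alphaReal_invPowIndex _).symm

theorem neg (hX : RealComputable o X) : RealComputable o fun t a => -X t a := by
  constructor
  · refine (hX.2.comp (f := fun x : A × ℕ => (x.1, negIndex x.2)) (by fun_prop)).congr
      fun t x => ?_
    rw [TTERep.alphaReal_negIndex, lt_neg]
  · refine (hX.1.comp (f := fun x : A × ℕ => (x.1, negIndex x.2)) (by fun_prop)).congr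
      fun t x => ?_
    rw [TTERep.alphaReal_negIndex, neg_lt]

theorem add (hX : RealComputable o X) (hY : RealComputable o Y) :
    RealComputable o fun t a => X t a + Y t a := by
  constructor
  · refine (Semidec.ex (P := fun t (x : A × ℕ) (s : ℕ × ℕ) =>
      (TTERep.alphaReal s.1 < X t x.1 ∧ TTERep.alphaReal s.2 < Y t x.1) ∧
        TTERep.alphaReal x.2 < TTERep.alphaReal (addIndex s.1 s.2))
      (Semidec.and (Semidec.and ?_ ?_) (Semidec.of_primrecPred ?_))).congr fun t x => ?_
    · exact hX.1.comp (f := fun y : (A × ℕ) × (ℕ × ℕ) => (y.1.1, y.2.1)) (by fun_prop)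
    · exact hY.1.comp (f := fun y : (A × ℕ) × (ℕ × ℕ) => (y.1.1, y.2.2)) (by fun_prop)
    · exact TTERep.primrecPred_alphaReal_lt (by fun_prop) (by fun_prop)
    · constructor
      · intro h
        obtain ⟨r, h1, h2⟩ := TTERep.exists_alphaReal_btwn
          (show X t x.1 - (X t x.1 + Y t x.1 - TTERep.alphaReal x.2) / 2 < X t x.1 by linarith)
        obtain ⟨s, h3, h4⟩ := TTERep.exists_alphaReal_btwn
          (show Y t x.1 - (X t x.1 + Y t x.1 - TTERep.alphaReal x.2) / 2 < Y t x.1 by linarith)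
        exact ⟨(r, s), ⟨h2, h4⟩, by rw [TTERep.alphaReal_addIndex]; linarith⟩
      · rintro ⟨⟨r, s⟩, ⟨h1, h2⟩, h3⟩
        rw [TTERep.alphaReal_addIndex] at h3
        simp only at h1 h2 h3
        linarith
  · refine (Semidec.ex (P := fun t (x : A × ℕ) (s : ℕ × ℕ) =>
      (X t x.1 < TTERep.alphaReal s.1 ∧ Y t x.1 < TTERep.alphaReal s.2) ∧
        TTERep.alphaReal (addIndex s.1 s.2) < TTERep.alphaReal x.2)
      (Semidec.and (Semidec.and ?_ ?_) (Semidec.of_primrecPred ?_))).congr fun t x => ?_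
    · exact hX.2.comp (f := fun y : (A × ℕ) × (ℕ × ℕ) => (y.1.1, y.2.1)) (by fun_prop)
    · exact hY.2.comp (f := fun y : (A × ℕ) × (ℕ × ℕ) => (y.1.1, y.2.2)) (by fun_prop)
    · exact TTERep.primrecPred_alphaReal_lt (by fun_prop) (by fun_prop)
    · constructor
      · intro h
        obtain ⟨r, h1, h2⟩ := TTERep.exists_alphaReal_btwn
          (show X t x.1 < X t x.1 + (TTERep.alphaReal x.2 - (X t x.1 + Y t x.1)) / 2 by linarith)
        obtain ⟨s, h3, h4⟩ := TTERep.exists_alphaReal_btwn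
          (show Y t x.1 < Y t x.1 + (TTERep.alphaReal x.2 - (X t x.1 + Y t x.1)) / 2 by linarith)
        exact ⟨(r, s), ⟨h1, h3⟩, by rw [TTERep.alphaReal_addIndex]; linarith⟩
      · rintro ⟨⟨r, s⟩, ⟨h1, h2⟩, h3⟩
        rw [TTERep.alphaReal_addIndex] at h3
        simp only at h1 h2 h3
        linarith

theorem sub (hX : RealComputable o X) (hY : RealComputable o Y) :
    RealComputable o fun t a => X t a - Y t a :=
  (hX.add hY.neg).congr fun _ _ => sub_eq_add_neg _ _

theorem half (hX : RealComputable o X) : RealComputable o fun t a => X t a / 2 := by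
  constructor
  · refine (hX.1.comp (f := fun x : A × ℕ => (x.1, addIndex x.2 x.2)) (by fun_prop)).congr
      fun t x => ?_
    rw [TTERep.alphaReal_addIndex, lt_div_iff₀ two_pos, mul_two]
  · refine (hX.2.comp (f := fun x : A × ℕ => (x.1, addIndex x.2 x.2)) (by fun_prop)).congr
      fun t x => ?_
    rw [TTERep.alphaReal_addIndex, div_lt_iff₀ two_pos, mul_two]

theorem sq (hX : RealComputable o X) (h0 : ∀ t a, 0 ≤ X t a) :
    RealComputable o fun t a => X t a ^ 2 := by
  constructor
  · -- A rational number below `x²` is negative or lies below `s²` for a rational `s ∈ (0, x)`.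
    refine (Semidec.or (Semidec.of_primrecPred (o := o)
      (S := fun x : A × ℕ => TTERep.alphaReal x.2 < TTERep.alphaReal 0)
      (TTERep.primrecPred_alphaReal_lt (by fun_prop) (by fun_prop)))
      (Semidec.ex (P := fun t (x : A × ℕ) s => TTERep.alphaReal s < X t x.1 ∧
        TTERep.alphaReal 0 < TTERep.alphaReal s ∧
        TTERep.alphaReal x.2 < TTERep.alphaReal (mulIndex s s))
      (Semidec.and ?_ (Semidec.of_primrecPred (PrimrecPred.and ?_ ?_))))).congr fun t x => ?_
    · exact hX.1.comp (f := fun y : (A × ℕ) × ℕ => (y.1.1, y.2)) (by fun_prop)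
    · exact TTERep.primrecPred_alphaReal_lt (by fun_prop) (by fun_prop)
    · exact TTERep.primrecPred_alphaReal_lt (by fun_prop) (by fun_prop)
    · simp only [TTERep.alphaReal_zero, TTERep.alphaReal_mulIndex]
      constructor
      · intro h
        by_cases hneg : TTERep.alphaReal x.2 < 0
        · exact Or.inl hneg
        · right
          simp only [not_lt] at hneg
          obtain ⟨s, h1, h2⟩ := TTERep.exists_alphaReal_btwn (Real.sqrt_lt' (lt_of_le_of_ne
            (h0 t x.1) (fun h' => by rw [← h'] at h; norm_num at h; linarith)) |>.2 h)
          have h3 := (Real.sqrt_nonneg _).trans_lt h1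
          exact ⟨s, h2, h3, by rw [Real.sqrt_lt' h3] at h1; nlinarith⟩
      · rintro (h | ⟨s, h1, h2, h3⟩)
        · exact h.trans_le (sq_nonneg _)
        · nlinarith
  · refine (Semidec.ex (P := fun t (x : A × ℕ) s => X t x.1 < TTERep.alphaReal s ∧
        TTERep.alphaReal (mulIndex s s) < TTERep.alphaReal x.2)
      (Semidec.and ?_ (Semidec.of_primrecPred ?_))).congr fun t x => ?_
    · exact hX.2.comp (f := fun y : (A × ℕ) × ℕ => (y.1.1, y.2)) (by fun_prop)
    · exact TTERep.primrecPred_alphaReal_lt (by fun_prop) (by fun_prop)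
    · simp only [TTERep.alphaReal_mulIndex]
      constructor
      · intro h
        obtain ⟨s, h1, h2⟩ := TTERep.exists_alphaReal_btwn (Real.lt_sqrt (h0 t x.1) |>.2 h)
        refine ⟨s, h1, ?_⟩
        rw [Real.lt_sqrt ((h0 t x.1).trans h1.le)] at h2
        nlinarith
      · rintro ⟨s, h1, h2⟩
        nlinarith [h0 t x.1]

/-- Substitution of a computable natural number. -/
theorem subst_nat {X : T → A → ℕ → ℝ} (hX : RealComputable o fun t (x : A × ℕ) => X t x.1 x.2)
    {f : T → A → ℕ} (hf : NatComputable o f) : RealComputable o fun t a => X t a (f t a) := by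
  have hf' := hf.comp (g := fun x : A × ℕ => x.1) (by fun_prop)
  constructor
  · exact Semidec.subst_nat (P := fun t (x : A × ℕ) m => TTERep.alphaReal x.2 < X t x.1 m)
      (hX.1.comp (f := fun y : (A × ℕ) × ℕ => ((y.1.1, y.2), y.1.2)) (by fun_prop)) hf'
  · exact Semidec.subst_nat (P := fun t (x : A × ℕ) m => X t x.1 m < TTERep.alphaReal x.2)
      (hX.2.comp (f := fun y : (A × ℕ) × ℕ => ((y.1.1, y.2), y.1.2)) (by fun_prop)) hf'

/-- The limit of a computable sequence that converges with the effective rate `2⁻ⁱ` is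
computable. -/
theorem limit {Y : T → A × ℕ → ℝ} (hY : RealComputable o Y)
    (h : ∀ t a i, |Y t (a, i) - X t a| ≤ 2⁻¹ ^ i) : RealComputable o X := by
  have small : ∀ ε : ℝ, 0 < ε → ∃ i : ℕ, (2⁻¹ : ℝ) ^ i < ε := fun ε hε =>
    exists_pow_lt_of_lt_one hε (by norm_num)
  constructor
  · refine (Semidec.ex (P := fun t (x : A × ℕ) i =>
      TTERep.alphaReal x.2 < Y t (x.1, i) - 2⁻¹ ^ i) (lt
        (alphaReal (f := fun z : (A × ℕ) × ℕ => z.1.2) (by fun_prop)) (sub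
        (hY.comp (f := fun z : (A × ℕ) × ℕ => (z.1.1, z.2)) (by fun_prop))
        (inv_two_pow (f := fun z : (A × ℕ) × ℕ => z.2) (by fun_prop))))).congr fun t x => ?_
    constructor
    · intro hx
      obtain ⟨i, hi⟩ := small ((X t x.1 - TTERep.alphaReal x.2) / 2) (by linarith)
      have := abs_le.1 (h t x.1 i)
      exact ⟨i, by linarith [this.1]⟩
    · rintro ⟨i, hi⟩
      have := abs_le.1 (h t x.1 i)
      linarith [this.2]
  · refine (Semidec.ex (P := fun t (x : A × ℕ) i =>
      Y t (x.1, i) + 2⁻¹ ^ i < TTERep.alphaReal x.2) (lt (add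
        (hY.comp (f := fun z : (A × ℕ) × ℕ => (z.1.1, z.2)) (by fun_prop))
        (inv_two_pow (f := fun z : (A × ℕ) × ℕ => z.2) (by fun_prop)))
        (alphaReal (f := fun z : (A × ℕ) × ℕ => z.1.2) (by fun_prop)))).congr fun t x => ?_
    constructor
    · intro hx
      obtain ⟨i, hi⟩ := small ((TTERep.alphaReal x.2 - X t x.1) / 2) (by linarith)
      have := abs_le.1 (h t x.1 i)
      exact ⟨i, by linarith [this.2]⟩
    · rintro ⟨i, hi⟩
      have := abs_le.1 (h t x.1 i)
      linarith [this.1]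

/-- A real number is computable from its names. -/
theorem of_name {Q : T → A → Cantor} (hQ : CantorComputable o Q)
    (h : ∀ t a, TTERep.real (Q t a) (X t a)) : RealComputable o X := by
  obtain ⟨n, hn, hd⟩ := PointComputable.of_name hQ h
  refine limit (Y := fun t y => TTERep.alphaReal (n t y)) ?_ fun t a i => ?_
  · exact subst_nat (X := fun _ _ m => TTERep.alphaReal m) (alphaReal (by fun_prop)) hn
  · simpa [Real.dist_eq] using hd t a i

/-- The real part of a complex number is computable from its names. -/
theorem re_of_name {Q : T → A → Cantor} {Z : T → A → ℂ} (hQ : CantorComputable o Q)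
    (h : ∀ t a, TTERep.complex (Q t a) (Z t a)) : RealComputable o fun t a => (Z t a).re := by
  obtain ⟨n, hn, hd⟩ := PointComputable.of_name hQ h
  refine limit (Y := fun t y => TTERep.alphaReal (n t y).unpair.1) ?_ fun t a i => ?_
  · exact subst_nat (X := fun _ _ m => TTERep.alphaReal m.unpair.1) (alphaReal (by fun_prop)) hn
  · refine le_trans ?_ (hd t a i)
    rw [dist_eq_norm]
    refine le_trans (le_of_eq ?_) (Complex.abs_re_le_norm _)
    rw [Complex.sub_re, TTERep.alphaComplex_re]

/-- Names of a computable real number are computable. -/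
theorem exists_name (hX : RealComputable o X) :
    ∃ Q : T → A → Cantor, CantorComputable o Q ∧ ∀ t a, TTERep.real (Q t a) (X t a) := by
  refine CantorComputable.exists_cauchy_name (P := fun t (y : A × ℕ) m =>
    X t y.1 - 2⁻¹ ^ (y.2 + 1) < TTERep.alphaReal m ∧
      TTERep.alphaReal m < X t y.1 + 2⁻¹ ^ (y.2 + 1)) ?_ (fun t y => ?_) fun t a i m hm => ?_
  · have h1 := hX.comp (f := fun z : (A × ℕ) × ℕ => z.1.1) (by fun_prop)
    have h2 : RealComputable o fun (_ : T) (z : (A × ℕ) × ℕ) => (2⁻¹ : ℝ) ^ (z.1.2 + 1) :=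
      inv_two_pow (by fun_prop)
    have h3 : RealComputable o fun (_ : T) (z : (A × ℕ) × ℕ) => TTERep.alphaReal z.2 :=
      alphaReal (by fun_prop)
    exact ((h1.sub h2).lt h3).and (h3.lt (h1.add h2))
  · have : (0 : ℝ) < 2⁻¹ ^ (y.2 + 1) := by positivity
    exact TTERep.exists_alphaReal_btwn (by linarith)
  · rw [Real.dist_eq, abs_lt]
    constructor <;> linarith [hm.1, hm.2]

/-- Names of a complex number with computable real and imaginary parts are computable. -/
theorem exists_complex_name {Z : T → A → ℂ} (hre : RealComputable o fun t a => (Z t a).re)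
    (him : RealComputable o fun t a => (Z t a).im) :
    ∃ Q : T → A → Cantor, CantorComputable o Q ∧ ∀ t a, TTERep.complex (Q t a) (Z t a) := by
  have close : ∀ {x : T → A → ℝ} (_ : RealComputable o x) {f : ℕ → ℕ} (_ : Primrec f),
      Semidec o fun t (z : (A × ℕ) × ℕ) =>
        x t z.1.1 - 2⁻¹ ^ (z.1.2 + 2) < TTERep.alphaReal (f z.2) ∧
          TTERep.alphaReal (f z.2) < x t z.1.1 + 2⁻¹ ^ (z.1.2 + 2) := by
    intro x hx f hf
    have h1 := hx.comp (f := fun z : (A × ℕ) × ℕ => z.1.1) (by fun_prop)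
    have h2 : RealComputable o fun (_ : T) (z : (A × ℕ) × ℕ) => (2⁻¹ : ℝ) ^ (z.1.2 + 2) :=
      inv_two_pow (by fun_prop)
    have h3 : RealComputable o fun (_ : T) (z : (A × ℕ) × ℕ) => TTERep.alphaReal (f z.2) :=
      alphaReal (by fun_prop)
    exact ((h1.sub h2).lt h3).and (h3.lt (h1.add h2))
  refine CantorComputable.exists_cauchy_name (P := fun t (y : A × ℕ) m =>
    ((Z t y.1).re - 2⁻¹ ^ (y.2 + 2) < TTERep.alphaReal m.unpair.1 ∧
      TTERep.alphaReal m.unpair.1 < (Z t y.1).re + 2⁻¹ ^ (y.2 + 2)) ∧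
    ((Z t y.1).im - 2⁻¹ ^ (y.2 + 2) < TTERep.alphaReal m.unpair.2 ∧
      TTERep.alphaReal m.unpair.2 < (Z t y.1).im + 2⁻¹ ^ (y.2 + 2)))
    ((close hre (f := fun m => m.unpair.1) (by fun_prop)).and
      (close him (f := fun m => m.unpair.2) (by fun_prop))) (fun t y => ?_) fun t a i m hm => ?_
  · have : (0 : ℝ) < 2⁻¹ ^ (y.2 + 2) := by positivity
    obtain ⟨r, hr⟩ := TTERep.exists_alphaReal_btwn
      (show (Z t y.1).re - 2⁻¹ ^ (y.2 + 2) < (Z t y.1).re + 2⁻¹ ^ (y.2 + 2) by linarith)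
    obtain ⟨s, hs⟩ := TTERep.exists_alphaReal_btwn
      (show (Z t y.1).im - 2⁻¹ ^ (y.2 + 2) < (Z t y.1).im + 2⁻¹ ^ (y.2 + 2) by linarith)
    exact ⟨Nat.pair r s, by simpa using hr, by simpa using hs⟩
  · obtain ⟨⟨h1, h2⟩, h3, h4⟩ := hm
    simp only at h1 h2 h3 h4
    have h5 : (2⁻¹ : ℝ) ^ (i + 1) = 2⁻¹ ^ (i + 2) + 2⁻¹ ^ (i + 2) := by ring
    rw [dist_eq_norm, h5]
    refine (Complex.norm_le_abs_re_add_abs_im _).trans_lt (add_lt_add ?_ ?_)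
    · rw [abs_lt]
      rw [Complex.sub_re, TTERep.alphaComplex_re]
      constructor <;> linarith
    · rw [abs_lt]
      rw [Complex.sub_im, TTERep.alphaComplex_im]
      constructor <;> linarith

end RealComputable

/-! ### Computable Hilbert spaces -/

open TTERep (alphaComplex negIndex)

/-- An index of `i z` for a rational complex number `z`. -/
def mulIIndex (m : ℕ) : ℕ := Nat.pair (negIndex m.unpair.2) m.unpair.1

theorem alphaComplex_mulIIndex (m : ℕ) :
    alphaComplex (mulIIndex m) = Complex.I * alphaComplex m := by
  apply Complex.ext <;>
  simp [TTERep.alphaComplex_re, TTERep.alphaComplex_im, mulIIndex, TTERep.alphaReal_negIndex]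

/-- Every finite sequence of natural numbers is coded by a tuple. -/
theorem exists_tupleEntry_eq (k : ℕ) (g : ℕ → ℕ) : ∃ m, ∀ i < k + 1, tupleEntry k m i = g i := by
  induction k generalizing g with
  | zero => exact ⟨g 0, fun i hi => by obtain rfl : i = 0 := by omega
                                       simp [tupleEntry]⟩
  | succ k ih =>
    obtain ⟨m, hm⟩ := ih fun i => g (i + 1)
    refine ⟨Nat.pair (g 0) m, fun i hi => ?_⟩
    cases i with
    | zero => simp [tupleEntry]
    | succ i =>
      rw [← hm i (by omega)]
      simp only [tupleEntry, Nat.add_lt_add_iff_right, Function.iterate_succ_apply,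
        Nat.unpair_pair]

theorem primrec_tupleEntry {A : Type*} [Primcodable A] {k m i : A → ℕ} (hk : Primrec k)
    (hm : Primrec m) (hi : Primrec i) : Primrec fun a => tupleEntry (k a) (m a) (i a) := by
  have it : ∀ {j : A → ℕ}, Primrec j →
      Primrec fun a => (fun r : ℕ => r.unpair.2)^[j a] (m a) := fun hj =>
    Primrec.nat_iterate hj hm (h := fun _ r => r.unpair.2) (by unfold Primrec₂; fun_prop)
  have h1 := it hi
  have h2 := it hk
  exact Primrec.ite (by fun_prop) (by fun_prop) h2

section

variable {T A H : Type*} [Primcodable A] [NormedAddCommGroup H] [InnerProductSpace ℂ H]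
  {e : ℕ → H} {o : T → Cantor}

/-- Multiplication by `i` is computable on rational linear combinations. It is the only part of the
linear structure that has to be taken from the coefficients: distances determine the real part of
the inner product, but not multiplication by `i`. -/
theorem exists_natComputable_I_smul (e : ℕ → H) (o : T → Cantor) :
    ∃ J : T → ℕ → ℕ, NatComputable o J ∧
      ∀ t m, alphaSpan e (J t m) = Complex.I • alphaSpan e m := by
  let P : ℕ → ℕ → Prop := fun m m' => m'.unpair.1 = m.unpair.1 ∧ ∀ i < m.unpair.1 + 1,
    tupleEntry m.unpair.1 m'.unpair.2 i = mulIIndex (tupleEntry m.unpair.1 m.unpair.2 i)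
  have hP : PrimrecPred fun x : ℕ × ℕ => P x.1 x.2 := by
    refine PrimrecPred.and (by fun_prop) (PrimrecPred.forall_fun_lt
      (R := fun y : (ℕ × ℕ) × ℕ => tupleEntry y.1.1.unpair.1 y.1.2.unpair.2 y.2 =
        mulIIndex (tupleEntry y.1.1.unpair.1 y.1.1.unpair.2 y.2)) (by fun_prop) ?_)
    have h1 : Primrec fun y : (ℕ × ℕ) × ℕ => tupleEntry y.1.1.unpair.1 y.1.2.unpair.2 y.2 :=
      primrec_tupleEntry (by fun_prop) (by fun_prop) (by fun_prop)
    have h2 : Primrec fun y : (ℕ × ℕ) × ℕ => tupleEntry y.1.1.unpair.1 y.1.1.unpair.2 y.2 :=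
      primrec_tupleEntry (by fun_prop) (by fun_prop) (by fun_prop)
    unfold mulIIndex
    fun_prop
  obtain ⟨J, hJ, hPJ⟩ := Semidec.exists_natComputable (o := o) (P := fun _ m m' => P m m')
    (Semidec.of_primrecPred hP) fun _ m => by
      obtain ⟨m', hm'⟩ := exists_tupleEntry_eq m.unpair.1
        fun i => mulIIndex (tupleEntry m.unpair.1 m.unpair.2 i)
      exact ⟨Nat.pair m.unpair.1 m', by simp, by simpa using hm'⟩
  refine ⟨J, hJ, fun t m => ?_⟩
  obtain ⟨h1, h2⟩ := hPJ t m
  rw [alphaSpan, alphaSpan, h1, Finset.smul_sum]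
  refine Finset.sum_congr rfl fun i hi => ?_
  rw [h2 i (Finset.mem_range.1 hi), alphaComplex_mulIIndex, mul_smul]

theorem alphaSpan_zero (e : ℕ → H) : alphaSpan e 0 = 0 := by
  simp [alphaSpan, tupleEntry, alphaComplex, TTERep.alphaReal_zero]

theorem NatComputable.comp_nat {J : T → ℕ → ℕ} (hJ : NatComputable o J) {f : T → A → ℕ}
    (hf : NatComputable o f) : NatComputable o fun t a => J t (f t a) :=
  Semidec.subst_nat (P := fun t (x : A × ℕ) m => J t m = x.2)
    (Semidec.comp (f := fun y : (A × ℕ) × ℕ => (y.2, y.1.2)) hJ (by fun_prop))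
    (hf.comp (g := fun x : A × ℕ => x.1) (by fun_prop))

theorem PointComputable.I_smul {x : T → A → H} (hx : PointComputable (alphaSpan e) o x) :
    PointComputable (alphaSpan e) o fun t a => Complex.I • x t a := by
  obtain ⟨n, hn, hd⟩ := hx
  obtain ⟨J, hJ, hI⟩ := exists_natComputable_I_smul e o
  refine ⟨fun t y => J t (n t y), hJ.comp_nat hn, fun t a i => ?_⟩
  rw [hI, dist_smul₀, Complex.norm_I, one_mul]
  exact hd t a i

theorem PointComputable.of_primrec {X : Type*} [MetricSpace X] {α : ℕ → X} {f : A → ℕ}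
    (hf : Primrec f) : PointComputable α o fun (_ : T) a => α (f a) :=
  ⟨fun _ y => f y.1, NatComputable.of_primrec (by fun_prop), fun t a i => by simp⟩

theorem PointComputable.zero : PointComputable (alphaSpan e) o fun (_ : T) (_ : A) => (0 : H) := by
  rw [← alphaSpan_zero e]
  exact of_primrec (f := fun _ => 0) (by fun_prop)

/-- The program that computes the distances between members of the dense sequence reads names of
their indices, which are themselves computable. -/
theorem IsComputableMetricSpace.realComputable_dist {X : Type*} [MetricSpace X] {α : ℕ → X}
    (h : IsComputableMetricSpace α) (o : T → Cantor) :
    RealComputable o fun _ (x : ℕ × ℕ) => dist (α x.1) (α x.2) := by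
  obtain ⟨c, hc⟩ := h.2
  have h1 : ∀ x : ℕ × ℕ, ∃ q, Cantor.Transforms c
      (Cantor.pair (fun k => decide (k < x.1)) (fun k => decide (k < x.2))) q ∧
      TTERep.real q (dist (α x.1) (α x.2)) := fun x =>
    hc _ x ⟨_, _, rfl, rfl, rfl⟩ (Set.mem_univ x)
  choose q hq hr using h1
  have h2 : CantorComputable o fun _ (x : ℕ × ℕ) => fun k => decide (k < x.1) :=
    CantorComputable.of_primrec (q := fun x : ℕ × ℕ => fun k => decide (k < x.1))
      (primrecPred_iff_primrec_decide.1 (by fun_prop))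
  have h3 : CantorComputable o fun _ (x : ℕ × ℕ) => fun k => decide (k < x.2) :=
    CantorComputable.of_primrec (q := fun x : ℕ × ℕ => fun k => decide (k < x.2))
      (primrecPred_iff_primrec_decide.1 (by fun_prop))
  have h4 : CantorComputable o fun _ (x : ℕ × ℕ) => q x :=
    (h2.pair h3).of_transforms (c := fun _ _ => Encodable.encode c)
      (NatComputable.of_primrec (by fun_prop)) fun _ x => by
        rw [Denumerable.ofNat_encode]; exact hq x
  exact RealComputable.of_name h4 fun _ x => hr x

theorem IsComputableMetricSpace.dist {X : Type*} [MetricSpace X] {α : ℕ → X}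
    (h : IsComputableMetricSpace α) {x y : T → A → X} (hx : PointComputable α o x)
    (hy : PointComputable α o y) : RealComputable o fun t a => dist (x t a) (y t a) := by
  obtain ⟨n, hn, hnx⟩ := hx
  obtain ⟨m, hm, hmy⟩ := hy
  refine RealComputable.limit
    (Y := fun t z => Dist.dist (α (n t (z.1, z.2 + 1))) (α (m t (z.1, z.2 + 1)))) ?_
    fun t a i => ?_
  · refine RealComputable.subst_nat
      (X := fun t (z : A × ℕ) k => Dist.dist (α k) (α (m t (z.1, z.2 + 1)))) ?_
      (hn.comp (g := fun z : A × ℕ => (z.1, z.2 + 1)) (by fun_prop))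
    exact RealComputable.subst_nat
      (X := fun t (z : (A × ℕ) × ℕ) k => Dist.dist (α z.2) (α k))
      ((h.realComputable_dist o).comp (f := fun z : ((A × ℕ) × ℕ) × ℕ => (z.1.2, z.2))
        (by fun_prop))
      (hm.comp (g := fun z : (A × ℕ) × ℕ => (z.1.1, z.1.2 + 1)) (by fun_prop))
  · have h1 := abs_le.1 (abs_dist_sub_le (α (n t (a, i + 1))) (x t a) (α (m t (a, i + 1))))
    have h2 := abs_le.1 (abs_dist_sub_le (α (m t (a, i + 1))) (y t a) (x t a))
    have h3 : (2⁻¹ : ℝ) ^ i = 2⁻¹ ^ (i + 1) + 2⁻¹ ^ (i + 1) := by ring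
    have h4 := hnx t a (i + 1)
    have h5 := hmy t a (i + 1)
    rw [dist_comm _ (x t a), dist_comm (y t a)] at h2
    rw [abs_le]
    constructor <;> linarith [h1.1, h1.2, h2.1, h2.2]

theorem PointComputable.norm (he : IsComputableMetricSpace (alphaSpan e)) {x : T → A → H}
    (hx : PointComputable (alphaSpan e) o x) : RealComputable o fun t a => ‖x t a‖ :=
  (he.dist hx PointComputable.zero).congr fun _ _ => (dist_zero_right _).symm

/-- The real part of the inner product is computable by polarization. -/
theorem PointComputable.re_inner (he : IsComputableMetricSpace (alphaSpan e)) {x y : T → A → H}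
    (hx : PointComputable (alphaSpan e) o x) (hy : PointComputable (alphaSpan e) o y) :
    RealComputable o fun t a => (inner ℂ (x t a) (y t a)).re := by
  have h1 := (hx.norm he).sq fun _ _ => norm_nonneg _
  have h2 := (hy.norm he).sq fun _ _ => norm_nonneg _
  have h3 := (he.dist hx hy).sq fun _ _ => dist_nonneg
  refine ((h1.add h2).sub h3).half.congr fun t a => ?_
  rw [dist_eq_norm, @norm_sub_sq ℂ]
  simp only [RCLike.re_to_complex]
  ring

/-- The inner product is conjugate linear in the first argument, so that
`Im ⟨x, y⟩ = Re ⟨i x, y⟩`. -/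
theorem PointComputable.im_inner (he : IsComputableMetricSpace (alphaSpan e)) {x y : T → A → H}
    (hx : PointComputable (alphaSpan e) o x) (hy : PointComputable (alphaSpan e) o y) :
    RealComputable o fun t a => (inner ℂ (x t a) (y t a)).im :=
  (hx.I_smul.re_inner he hy).congr fun t a => by simp

end

/-! ### The Riesz isomorphism on names -/

section

variable {H : Type*} [NormedAddCommGroup H] [InnerProductSpace ℂ H] {e : ℕ → H}

/-- Putting a fixed word in front of a name of `f` yields a name of the functional `⟨·, f⟩`. -/
theorem exists_inner_name (he : IsComputableMetricSpace (alphaSpan e)) :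
    ∃ w : List Bool, ∀ (z : Cantor) (f : H), TTERep.hilbert e z f →
      TTERep.func (TTERep.hilbert e) TTERep.complex (Cantor.append w z)
        (fun x => inner ℂ f x) := by
  let I := {s : Cantor × H // TTERep.hilbert e s.1 s.2}
  let T := {t : I × Cantor × H // TTERep.hilbert e t.2.1 t.2.2}
  let o : T → Cantor := fun t => Cantor.pair t.1.1.1.1 t.1.2.1
  have hor : CantorComputable o fun t (_ : Unit) => Cantor.pair t.1.1.1.1 t.1.2.1 :=
    CantorComputable.oracle
  have hf : PointComputable (alphaSpan e) o fun t (_ : Unit) => t.1.1.1.2 :=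
    PointComputable.of_name hor.fst fun t _ => t.1.1.2
  have hx : PointComputable (alphaSpan e) o fun t (_ : Unit) => t.1.2.2 :=
    PointComputable.of_name hor.snd fun t _ => t.2
  obtain ⟨Q, hQ, hname⟩ := RealComputable.exists_complex_name
    (hf.re_inner he hx) (hf.im_inner he hx)
  obtain ⟨w, hw⟩ := CantorComputable.exists_func_name (I := I) (r := fun i => i.1.1)
    (f := fun i x => inner ℂ i.1.2 x) hQ fun t => hname t ()
  exact ⟨w, fun z f hz => hw ⟨(z, f), hz⟩⟩

/-- The Riesz isomorphism is computable on sequences of vectors. -/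
theorem computableFunOn_functionalSeq (he : IsComputableMetricSpace (alphaSpan e))
    (S : Set (ℕ → H)) :
    ComputableFunOn (TTERep.seq (TTERep.hilbert e)) (TTERep.seq (TTERep.dual e))
      functionalSeq S := by
  let I := {s : Cantor × (ℕ → H) // TTERep.seq (TTERep.hilbert e) s.1 s.2 ∧ s.2 ∈ S}
  let T := {t : I × Cantor × ℕ // TTERep.nat t.2.1 t.2.2}
  let o : T → Cantor := fun t => Cantor.pair t.1.1.1.1 t.1.2.1
  have hor : CantorComputable o fun t (_ : Unit) => Cantor.pair t.1.1.1.1 t.1.2.1 :=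
    CantorComputable.oracle
  have h1 : ∀ (t : T) (_ : Unit), ∃ z, Cantor.Eta t.1.1.1.1 t.1.2.1 z ∧
      TTERep.hilbert e z (t.1.1.1.2 t.1.2.2) := fun t _ => t.1.1.2.1 _ _ t.2
  choose z hz hzn using h1
  have hzc : CantorComputable o z := hor.fst.of_eta hor.snd hz
  obtain ⟨w, hw⟩ := exists_inner_name he
  obtain ⟨b, hb, hbn⟩ := ((PointComputable.of_name hzc hzn).norm he).exists_name
  obtain ⟨w', hw'⟩ := CantorComputable.exists_func_name (I := I) (δ := TTERep.nat)
    (δ' := TTERep.dual e) (r := fun i => i.1.1) (f := fun i => functionalSeq i.1.2)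
    ((hzc.append w).pair hb) fun t =>
      ⟨_, _, rfl, hw _ _ (hzn t ()), by
        simpa [functionalSeq, innerSL_apply_norm] using hbn t ()⟩
  have hout : CantorComputable (fun i : I => i.1.1) fun i (_ : Unit) => Cantor.append w' i.1.1 :=
    CantorComputable.oracle.append w'
  exact ComputableFunOn.of_cantorComputable hout hw'

/-- The inverse of the Riesz isomorphism is computable on sequences of functionals. A vector `f`
is found by testing the members `v` of the dense sequence for a small value of
`‖v - f‖² = ‖v‖² + ‖Λ‖² - 2 Re Λ(v)`, where `Λ = ⟨·, f⟩`; this is why names of functionals have to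
contain the norm. -/
theorem computableFunOn_of_functionalSeq_eq (he : IsComputableMetricSpace (alphaSpan e))
    {g : (ℕ → StrongDual ℂ H) → ℕ → H} {S : Set (ℕ → StrongDual ℂ H)}
    (hg : ∀ Λ ∈ S, functionalSeq (g Λ) = Λ) :
    ComputableFunOn (TTERep.seq (TTERep.dual e)) (TTERep.seq (TTERep.hilbert e)) g S := by
  let I := {s : Cantor × (ℕ → StrongDual ℂ H) // TTERep.seq (TTERep.dual e) s.1 s.2 ∧ s.2 ∈ S}
  let T := {t : I × Cantor × ℕ // TTERep.nat t.2.1 t.2.2}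
  let o : T → Cantor := fun t => Cantor.pair t.1.1.1.1 t.1.2.1
  have hor : CantorComputable o fun t (_ : Unit) => Cantor.pair t.1.1.1.1 t.1.2.1 :=
    CantorComputable.oracle
  let Λ : T → StrongDual ℂ H := fun t => t.1.1.1.2 t.1.2.2
  let f : T → H := fun t => g t.1.1.1.2 t.1.2.2
  have hΛ : ∀ t x, Λ t x = inner ℂ (f t) x := fun t x => by
    change t.1.1.1.2 t.1.2.2 x = _
    rw [← hg _ t.1.1.2.2]
    simp [functionalSeq, f]
  have h1 : ∀ (t : T) (_ : Unit), ∃ p q, Cantor.Eta t.1.1.1.1 t.1.2.1 (Cantor.pair p q) ∧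
      TTERep.func (TTERep.hilbert e) TTERep.complex p (fun x => Λ t x) ∧
      TTERep.real q ‖Λ t‖ := by
    intro t _
    obtain ⟨z, hz, p, q, rfl, hp, hq⟩ := t.1.1.2.1 _ _ t.2
    exact ⟨p, q, hz, hp, hq⟩
  choose p q hpq hp hq using h1
  have hpqc : CantorComputable o fun t a => Cantor.pair (p t a) (q t a) :=
    hor.fst.of_eta hor.snd hpq
  have hnorm : RealComputable o fun t (_ : Unit) => ‖f t‖ :=
    (RealComputable.of_name hpqc.snd hq).congr fun t a => by
      have h2 : Λ t = innerSL ℂ (f t) := ContinuousLinearMap.ext fun x => by simp [hΛ]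
      rw [h2, innerSL_apply_norm]
  -- Names of the members of the dense sequence, as arguments for the functionals.
  obtain ⟨v, hv, hvn⟩ := CantorComputable.exists_cauchy_name (o := o) (α := alphaSpan e)
    (x := fun _ (m : ℕ) => alphaSpan e m) (P := fun _ (y : ℕ × ℕ) k => k = y.1)
    (Semidec.of_primrecPred (by fun_prop)) (fun _ y => ⟨y.1, rfl⟩)
    (by rintro t m i _ rfl; simp)
  have h3 : ∀ (t : T) (m : ℕ), ∃ z, Cantor.Eta (p t ()) (v t m) z ∧
      TTERep.complex z (Λ t (alphaSpan e m)) := fun t m => hp t () _ _ (hvn t m)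
  choose z hz hzn using h3
  have hzc : CantorComputable o z :=
    (hpqc.fst.comp (f := fun _ : ℕ => ()) (by fun_prop)).of_eta hv hz
  have hre : RealComputable o fun t m => (inner ℂ (f t) (alphaSpan e m)).re :=
    (RealComputable.re_of_name hzc hzn).congr fun t m => by rw [hΛ]
  have hα : RealComputable o fun (_ : T) m => ‖alphaSpan e m‖ :=
    (PointComputable.of_primrec (f := fun m => m) (by fun_prop)).norm he
  have hdist : RealComputable o fun t m => dist (alphaSpan e m) (f t) ^ 2 := by
    refine (((hα.sq fun _ _ => norm_nonneg _).add ((hnorm.comp (f := fun _ : ℕ => ())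
      (by fun_prop)).sq fun _ _ => norm_nonneg _)).sub (hre.add hre)).congr fun t m => ?_
    rw [dist_comm, dist_eq_norm, @norm_sub_sq ℂ]
    simp only [RCLike.re_to_complex]
    ring
  obtain ⟨Q, hQ, hQn⟩ := CantorComputable.exists_cauchy_name (o := o) (α := alphaSpan e)
    (x := fun t (_ : Unit) => f t)
    (P := fun t y m => dist (alphaSpan e m) (f t) ^ 2 < (2⁻¹ ^ (y.2 + 1)) ^ 2)
    ((hdist.comp (f := fun x : (Unit × ℕ) × ℕ => x.2) (by fun_prop)).lt
      ((RealComputable.inv_two_pow (f := fun x : (Unit × ℕ) × ℕ => x.1.2 + 1)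
        (by fun_prop)).sq fun _ _ => by positivity))
    (fun t y => by
      obtain ⟨m, hm⟩ := he.1.exists_dist_lt (f t) (ε := 2⁻¹ ^ (y.2 + 1)) (by positivity)
      rw [dist_comm] at hm
      exact ⟨m, pow_lt_pow_left₀ hm dist_nonneg two_ne_zero⟩)
    fun t a i m hm => lt_of_pow_lt_pow_left₀ 2 (by positivity) hm
  obtain ⟨w, hw⟩ := CantorComputable.exists_func_name (I := I) (δ := TTERep.nat)
    (δ' := TTERep.hilbert e) (r := fun i => i.1.1) (f := fun i => g i.1.2) hQ fun t => hQn t ()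
  have hout : CantorComputable (fun i : I => i.1.1) fun i (_ : Unit) => Cantor.append w i.1.1 :=
    CantorComputable.oracle.append w
  exact ComputableFunOn.of_cantorComputable hout hw

/-- The frame inequalities for `(fᵢ)` are literally the g-frame inequalities for `(⟨·, fᵢ⟩)`, so
that the Riesz representation theorem yields the bijection. -/
theorem bijOn_functionalSeq [CompleteSpace H] :
    Set.BijOn functionalSeq {f : ℕ → H | IsFrame f}
      {Λ : ℕ → StrongDual ℂ H | IsGFrame (E := fun _ => ℂ) Λ} := by
  refine ⟨fun f hf => hf, fun f _ g _ hfg => ?_, fun Λ hΛ => ?_⟩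
  · funext i
    exact ext_inner_right ℂ fun x => by
      simpa [functionalSeq] using congrArg (fun Λ => Λ i x) hfg
  · have h : functionalSeq (fun i => (InnerProductSpace.toDual ℂ H).symm (Λ i)) = Λ := by
      funext i
      ext x
      simp [functionalSeq]
    refine ⟨_, ?_, h⟩
    rw [← h] at hΛ
    exact hΛ

end

theorem theorem3p2 {H : Type*} [NormedAddCommGroup H] [InnerProductSpace ℂ H] [CompleteSpace H]
    (e : ℕ → H) (he : IsComputableHilbertSpace e) :
    Set.BijOn functionalSeq {f : ℕ → H | IsFrame f}
      {Λ : ℕ → StrongDual ℂ H | IsGFrame (E := fun _ => ℂ) Λ} ∧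
    ComputableFunOn (TTERep.seq (TTERep.hilbert e))
      (TTERep.seq (TTERep.dual e))
      functionalSeq {f : ℕ → H | IsFrame f} ∧
    ComputableFunOn (TTERep.seq (TTERep.dual e))
      (TTERep.seq (TTERep.hilbert e))
      (Function.invFunOn functionalSeq {f : ℕ → H | IsFrame f})
      (functionalSeq '' {f : ℕ → H | IsFrame f}) :=
  ⟨bijOn_functionalSeq, computableFunOn_functionalSeq he.2 _,
    computableFunOn_of_functionalSeq_eq he.2 fun _ hΛ => Function.invFunOn_eq hΛ⟩
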